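/- Let $d\ge 2$ and $\alpha,\beta>0$. Then there are constants $c_d,C_d>0$, depending only on $d,\alpha,\beta$, such that the following holds. Let $K:[0,\infty)\to[0,1]$ be a measurable function with $K(x)\ge\alpha$ for all $0\le x\le 1$ and $K(x)\le \beta\,x^{-d}e^{-(x+1)\log(x+1)}$ for all $x>1$, and let $(r_n)$ be a sequence of positive reals. For each $n$ let $\mathcal G_n$ be the following temporal soft random geometric graph. Its vertices are $n$ independent uniform points of the unit torus $(\mathbb R/\mathbb Z)^d$. Given these points, each pair $\{u,v\}$ of distinct vertices is, independently of the other pairs, an edge with probability $K(\|u-v\|/r_n)$, where $\|\cdot\|$ denotes Euclidean distance on the torus. Finally, each edge $e$ receives a time-stamp $\tau_e$; the time-stamps are independent and uniform on $[0,1]$, independent of everything else. A temporal path from $u$ to $v$ is a path from $u$ to $v$ along which the time-stamps of the edges are non-decreasing; a vertex $u$ is a temporal source if there is a temporal path from $u$ to every vertex; and $\mathcal G_n$ is temporally connected if every vertex is a temporal source. (i) If $r_n\le c_d\,n^{-1/(d+1)}$ for all sufficiently large $n$, then, with probability tending to $1$ as $n\to\infty$, $\mathcal G_n$ is not temporally connected;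 moreover, with probability tending to $1$, no vertex of $\mathcal G_n$ is a temporal source. (ii) If $r_n\ge C_d\,n^{-1/(d+1)}$ for all sufficiently large $n$, then, with probability tending to $1$ as $n\to\infty$, $\mathcal G_n$ is temporally connected, that is, for every ordered pair $(u,v)$ of vertices there is a temporal path from $u$ to $v$. -/

import Mathlib

open MeasureTheory Filter Topology

/-- A temporal graph on the vertex set `V`: a simple graph together with real time-stamps of its
edges. The values of `stamp` off the edge set of `graph` play no role. -/
structure TemporalGraph (V : Type*) where
  /-- the underlying simple graph -/
  graph : SimpleGraph V
  /-- the time-stamp of each edge -/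
  stamp : Sym2 V → ℝ

namespace TemporalGraph

variable {V : Type*}

/-- There is a temporal path from `u` to `v`: a path of the underlying graph along which the
time-stamps are non-decreasing. (The one-vertex path is a temporal path from `u` to `u`.) -/
def HasTemporalPath (T : TemporalGraph V) (u v : V) : Prop :=
  ∃ p : T.graph.Walk u v, p.IsPath ∧ p.edges.Pairwise (fun e f => T.stamp e ≤ T.stamp f)

/-- `u` is a temporal source: every vertex is reached from `u` by a temporal path. -/
def IsTemporalSource (T : TemporalGraph V) (u : V) : Prop :=
  ∀ v : V, T.HasTemporalPath u v

/-- Every vertex is a temporal source. -/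
def TemporallyConnected (T : TemporalGraph V) : Prop :=
  ∀ u : V, T.IsTemporalSource u

end TemporalGraph

/-- The Euclidean distance on the unit torus `(ℝ / ℤ) ^ d`. The norm of an element of
`UnitAddCircle = ℝ / ℤ` is its distance to `0`, i.e. the distance of a representative to the
nearest integer. -/
noncomputable def torusDist {d : ℕ} (x y : UnitAddTorus (Fin d)) : ℝ :=
  Real.sqrt (∑ i, ‖x i - y i‖ ^ 2)

/-- The sample space for a temporal random geometric graph with `n` vertices on the
`d`-dimensional unit torus. Its measure `volume` is the product measure, so that all the
coordinates are independent and uniform: the positions of the `n` vertices, and, for each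
unordered pair of vertices, a mark in `[0, 1]` that decides whether the pair is an edge and a
time-stamp in `[0, 1]`. -/
abbrev TRGGSample (d n : ℕ) : Type :=
  (Fin n → UnitAddTorus (Fin d)) × (Sym2 (Fin n) → unitInterval) × (Sym2 (Fin n) → unitInterval)

/-- The temporal random geometric graph with kernel `K` and radius `r`. Two distinct vertices `u`,
`v` are adjacent when the uniform mark of the pair is smaller than `K (‖x u - x v‖ / r)`; thus,
given the positions, the edges are independent and present with these probabilities. The
time-stamps are independent of the positions and of the edges. -/
noncomputable def temporalRGG {d n : ℕ} (K : ℝ → ℝ) (r : ℝ) (ω : TRGGSample d n) :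
    TemporalGraph (Fin n) where
  graph :=
    { Adj := fun u v => u ≠ v ∧ (ω.2.1 s(u, v) : ℝ) < K (torusDist (ω.1 u) (ω.1 v) / r)
      symm := ⟨fun u v h => ⟨h.1.symm, by
        have h2 : torusDist (ω.1 v) (ω.1 u) = torusDist (ω.1 u) (ω.1 v) := by
          simp only [torusDist, norm_sub_rev]
        rw [Sym2.eq_swap, h2]
        exact h.2⟩⟩
      loopless := ⟨fun _ h => h.1 rfl⟩ }
  stamp := fun e => (ω.2.2 e : ℝ)

/-!
Put `L = n ^ (1 / (d + 1))`. Both halves compare the `1 / r` hops that are needed to cross the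
torus with the rate `n * r ^ d` at which a temporal walk can make hops: the crossing takes a time
of order `1 / (n * r ^ (d + 1))`, and the unit time interval suffices for it or not according to
the constant in `r = const / L`.

**Below the threshold** the argument is a first moment bound. Only `K t ≤ B * exp (-t)` is used
(`connection_le_exp`). Fix a self-avoiding sequence of vertices with `k` edges. Its time-stamps
are non-decreasing with probability at most `exp c / c ^ k` for every `c > 0`
(`volume_stamps_sorted_le`), since `exp c` times the product of `1{a ≤ b} * exp (-c * (b - a))`
along the sequence dominates the indicator. If the end point is at distance at least `1 / 8` from
the start, half of the exponential decay of `K` yields a factor `exp (-1 / (16 * r))`, and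
integrating the positions against the other half yields `(Γ * r ^ d) ^ k`
(`lintegral_chainProd_start_le`). With `c = 2 * n * Γ * r ^ d` the sum over the at most `n ^ k`
sequences and over `k` is at most `2 * exp (2 * n * Γ * r ^ d - 1 / (16 * r))`, which is at most
`2 * exp (-L / 32)` when the constant is small. This survives the union over the starting vertex,
and with probability exponentially close to `1` the vertices do not all lie within
distance `1 / 4` of each other, so that every vertex has some vertex at distance at least `1 / 8`
from it.

**Above the threshold** only edges of length at most `C / L` with mark below `a = min α 1` are
used. Take a grid with `k` points per side, `k` of order `L / C`, and as cells the disjoint balls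
of radius `1 / (4 * k)` about the grid points in the supremum norm; vertices of a cell and of the
next one can be adjacent, and every point of the torus is close to some cell. With high
probability every cell holds `m` vertices,
`m` a constant multiple of `s = ⌈L⌉` (`volume_sparse_cell_le`). Cut the times
`[1 / 4, 3 / 4]` into `d * k` windows. As the windows have length of order `C / L`, for large `C`
any `s` vertices of a cell are joined to any `s` vertices of the next cell by an edge with
time-stamp in a given window, with failure probability so small that a union bound over all pairs
of sets of size `s` is affordable. Thus `s` reached vertices of a cell become at least `m - s ≥ s`
reached vertices of any next cell within one window, and after `d * (k - 1)` windows every cell is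
reached (`cell_spread`). The time before `1 / 4` lets the source reach its first `s` vertices, and
the time after `3 / 4` lets `s` vertices reach the target (`temporallyConnected_of_expansion`);
both are Chernoff bounds (`pi_card_lt_le`).
Since only a union bound is involved, no exploration process and no conditioning on the past is
needed.
-/

open scoped ENNReal

/-! ### Integrals over finite product spaces -/

theorem lintegral_pi_update {ι X : Type*} [Fintype ι] [DecidableEq ι] [MeasurableSpace X]
    (μ : Measure X) [IsProbabilityMeasure μ] {F : (ι → X) → ℝ≥0∞} (hF : Measurable F) (i : ι) :
    ∫⁻ x, F x ∂Measure.pi (fun _ : ι => μ) =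
      ∫⁻ x, ∫⁻ y, F (Function.update x i y) ∂μ ∂Measure.pi (fun _ : ι => μ) := by
  have hmeas : Measurable fun x : ι → X => ∫⁻ y, F (Function.update x i y) ∂μ := by
    have := hF.lmarginal (s := {i}) (fun _ : ι => μ)
    rwa [lmarginal_singleton] at this
  refine lintegral_eq_of_lmarginal_eq {i} hF hmeas ?_
  rw [lmarginal_singleton, lmarginal_singleton]
  funext x
  simp

/-- The product `g a x₁ * g x₁ x₂ * ⋯ * g xₖ₋₁ xₖ` of a kernel `g` along the steps of the sequence
`a, x₁, …, xₖ`. -/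
noncomputable def chainProd {X : Type*} (g : X → X → ℝ≥0∞) : X → List X → ℝ≥0∞
  | _, [] => 1
  | a, b :: l => g a b * chainProd g b l

theorem measurable_chainProd {ι X : Type*} [MeasurableSpace X] {g : X → X → ℝ≥0∞}
    (hg : Measurable (Function.uncurry g)) (l : List ι) :
    Measurable fun p : X × (ι → X) => chainProd g p.1 (l.map p.2) := by
  induction l with
  | nil => exact measurable_const
  | cons i l ih =>
    have h1 : Measurable fun p : X × (ι → X) => (p.2 i, p.2) := by fun_prop
    have h2 : Measurable fun p : X × (ι → X) => (p.1, p.2 i) := by fun_prop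
    exact (hg.comp h2).mul (ih.comp h1)

/-- Along a self-avoiding sequence of indices the coordinates can be integrated out one at a time,
the last one first. -/
theorem lintegral_chainProd_le {ι X : Type*} [Fintype ι] [DecidableEq ι] [MeasurableSpace X]
    (μ : Measure X) [IsProbabilityMeasure μ] {g : X → X → ℝ≥0∞}
    (hg : Measurable (Function.uncurry g)) {C : ℝ≥0∞} (hC : ∀ a, ∫⁻ b, g a b ∂μ ≤ C)
    {l : List ι} (hl : l.Nodup) (a : X) :
    ∫⁻ x, chainProd g a (l.map x) ∂Measure.pi (fun _ : ι => μ) ≤ C ^ l.length := by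
  induction l generalizing a with
  | nil => simp [chainProd]
  | cons i l ih =>
    obtain ⟨hi, hl⟩ := List.nodup_cons.1 hl
    have hm : Measurable fun p : X × (ι → X) => chainProd g p.1 (l.map p.2) :=
      measurable_chainProd hg l
    have hmeas : Measurable fun x : ι → X => chainProd g a ((i :: l).map x) :=
      (measurable_chainProd hg (i :: l)).comp (by fun_prop : Measurable fun x : ι → X => (a, x))
    have hupd : ∀ (x : ι → X) (y : X), l.map (Function.update x i y) = l.map x := fun x y =>
      List.map_congr_left fun j hj => Function.update_of_ne (ne_of_mem_of_not_mem hj hi) _ _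
    have hga : Measurable (g a) := hg.comp (by fun_prop : Measurable fun y : X => (a, y))
    rw [lintegral_pi_update μ hmeas i]
    simp only [List.map_cons, chainProd, Function.update_self, hupd]
    rw [lintegral_lintegral_swap]
    · calc ∫⁻ y, ∫⁻ x, g a y * chainProd g y (l.map x) ∂Measure.pi (fun _ : ι => μ) ∂μ
          = ∫⁻ y, g a y * ∫⁻ x, chainProd g y (l.map x) ∂Measure.pi (fun _ : ι => μ) ∂μ := by
            refine lintegral_congr fun y => lintegral_const_mul _ ?_
            exact hm.comp (by fun_prop : Measurable fun x : ι → X => (y, x))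
        _ ≤ ∫⁻ y, g a y * C ^ l.length ∂μ := by
            gcongr with y
            exact ih hl y
        _ ≤ C ^ (i :: l).length := by
            rw [lintegral_mul_const _ hga, List.length_cons, pow_succ']
            gcongr
            exact hC a
    · refine Measurable.aemeasurable ?_
      exact (hga.comp measurable_snd).mul (hm.comp measurable_swap)

theorem lintegral_chainProd_start_le {ι X : Type*} [Fintype ι] [DecidableEq ι]
    [MeasurableSpace X] (μ : Measure X) [IsProbabilityMeasure μ] {g : X → X → ℝ≥0∞}
    (hg : Measurable (Function.uncurry g)) {C : ℝ≥0∞} (hC : ∀ a, ∫⁻ b, g a b ∂μ ≤ C)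
    {i : ι} {l : List ι} (hl : (i :: l).Nodup) :
    ∫⁻ x, chainProd g (x i) (l.map x) ∂Measure.pi (fun _ : ι => μ) ≤ C ^ l.length := by
  obtain ⟨hi, hl⟩ := List.nodup_cons.1 hl
  have hm : Measurable fun p : X × (ι → X) => chainProd g p.1 (l.map p.2) :=
    measurable_chainProd hg l
  have hupd : ∀ (x : ι → X) (y : X), l.map (Function.update x i y) = l.map x := fun x y =>
    List.map_congr_left fun j hj => Function.update_of_ne (ne_of_mem_of_not_mem hj hi) _ _
  have hmeas : Measurable fun x : ι → X => chainProd g (x i) (l.map x) :=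
    hm.comp (by fun_prop : Measurable fun x : ι → X => (x i, x))
  rw [lintegral_pi_update μ hmeas i]
  simp only [Function.update_self, hupd]
  rw [lintegral_lintegral_swap]
  swap
  · exact (hm.comp measurable_swap).aemeasurable
  calc _ ≤ ∫⁻ _ : X, C ^ l.length ∂μ := lintegral_mono fun y => lintegral_chainProd_le μ hg hC hl y
    _ = _ := by simp

theorem lintegral_pi_prod {ι X : Type*} [Fintype ι] [MeasurableSpace X]
    (μ : Measure X) [IsProbabilityMeasure μ] (F : Finset ι) {f : ι → X → ℝ≥0∞}
    (hf : ∀ i, Measurable (f i)) :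
    ∫⁻ x, ∏ i ∈ F, f i (x i) ∂Measure.pi (fun _ : ι => μ) = ∏ i ∈ F, ∫⁻ y, f i y ∂μ := by
  refine (ProbabilityTheory.lintegral_prod_eq_prod_lintegral_of_indepFun F
    (fun i (x : ι → X) => f i (x i)) (ProbabilityTheory.iIndepFun_pi fun i => (hf i).aemeasurable)
    (fun i => (hf i).comp (measurable_pi_apply i))).trans ?_
  refine Finset.prod_congr rfl fun i _ => ?_
  exact (measurePreserving_eval (fun _ : ι => μ) i).lintegral_comp (hf i)

theorem pi_forall_mem_le {ι X : Type*} [Fintype ι] [MeasurableSpace X]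
    (μ : Measure X) [IsProbabilityMeasure μ] (F : Finset ι) (E : ι → Set X) :
    Measure.pi (fun _ : ι => μ) {x | ∀ i ∈ F, x i ∈ E i} ≤ ∏ i ∈ F, μ (E i) := by
  classical
  have : {x : ι → X | ∀ i ∈ F, x i ∈ E i} =
      Set.univ.pi fun i => if i ∈ F then E i else Set.univ := by
    ext x
    simp only [Set.mem_ofPred_eq, Set.mem_pi, Set.mem_univ, true_implies]
    refine forall_congr' fun i => ?_
    by_cases h : i ∈ F <;> simp [h]
  rw [this, Measure.pi_pi]
  simp only [apply_ite μ, measure_univ]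
  rw [Finset.prod_ite_mem, Finset.univ_inter]

open scoped Classical in
/-- A Chernoff bound for the lower tail of the number of successes among the trials in `F`: compare
the indicator of fewer than `s` successes with `2 ^ s * 2 ^ (-successes)`. -/
theorem pi_card_lt_le {ι X : Type*} [Fintype ι] [MeasurableSpace X]
    (μ : Measure X) [IsProbabilityMeasure μ] (F : Finset ι) {E : ι → Set X}
    (hE : ∀ i, MeasurableSet (E i)) {p : ℝ}
    (hp : ∀ i ∈ F, ENNReal.ofReal p ≤ μ (E i)) (s : ℕ) :
    Measure.pi (fun _ : ι => μ) {x | (F.filter fun i => x i ∈ E i).card < s} ≤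
      ENNReal.ofReal (2 ^ s * Real.exp (-(p / 2 * F.card))) := by
  set f : ι → X → ℝ≥0∞ := fun i => (E i).indicator (fun _ => 2⁻¹) + (E i)ᶜ.indicator fun _ => 1
  have hf : ∀ i, Measurable (f i) := fun i =>
    (measurable_const.indicator (hE i)).add (measurable_const.indicator (hE i).compl)
  have hf1 : ∀ i y, f i y = if y ∈ E i then 2⁻¹ else 1 := by
    intro i y
    by_cases h : y ∈ E i <;> simp [f, h]
  have hint : ∀ i ∈ F, ∫⁻ y, f i y ∂μ ≤ ENNReal.ofReal (Real.exp (-(p / 2))) := by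
    intro i hi
    have h1 : ∫⁻ y, f i y ∂μ = 2⁻¹ * μ (E i) + μ (E i)ᶜ := by
      simp only [f, Pi.add_apply]
      rw [lintegral_add_left (measurable_const.indicator (hE i)),
        lintegral_indicator_const (hE i), lintegral_indicator_const (hE i).compl, one_mul]
    have h2 : (2⁻¹ : ℝ≥0∞) = ENNReal.ofReal (2⁻¹ : ℝ) := by
      rw [ENNReal.ofReal_inv_of_pos two_pos]; simp
    have h3 : p ≤ μ.real (E i) := by
      rw [measureReal_def]
      exact (ENNReal.ofReal_le_iff_le_toReal (measure_ne_top _ _)).1 (hp i hi)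
    rw [h1, ← ofReal_measureReal (s := E i), ← ofReal_measureReal (s := (E i)ᶜ), h2,
      ← ENNReal.ofReal_mul (by norm_num), ← ENNReal.ofReal_add (by positivity) (by positivity),
      probReal_compl_eq_one_sub (hE i)]
    apply ENNReal.ofReal_le_ofReal
    have := Real.add_one_le_exp (-(p / 2))
    linarith
  have hmeas : Measurable fun x : ι → X => ∏ i ∈ F, f i (x i) :=
    Finset.measurable_prod _ fun i _ => (hf i).comp (measurable_pi_apply i)
  have hprod : ∀ x : ι → X, ∏ i ∈ F, f i (x i) =
      2⁻¹ ^ (F.filter fun i => x i ∈ E i).card := by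
    intro x
    simp only [hf1]
    rw [Finset.prod_ite]
    simp
  calc Measure.pi (fun _ : ι => μ) {x | (F.filter fun i => x i ∈ E i).card < s}
      ≤ Measure.pi (fun _ : ι => μ) {x | 1 ≤ 2 ^ s * ∏ i ∈ F, f i (x i)} := by
        refine measure_mono fun x hx => ?_
        simp only [Set.mem_ofPred_eq] at hx ⊢
        rw [hprod]
        calc (1 : ℝ≥0∞) = 2 ^ s * 2⁻¹ ^ s := by
              rw [← mul_pow, ENNReal.mul_inv_cancel (by simp) (by simp), one_pow]
          _ ≤ _ := by
              gcongr 2 ^ s * ?_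
              exact pow_le_pow_right_of_le_one' (by simp) hx.le
    _ ≤ ∫⁻ x, 2 ^ s * ∏ i ∈ F, f i (x i) ∂Measure.pi (fun _ : ι => μ) := by
        simpa using mul_meas_ge_le_lintegral (hmeas.const_mul (2 ^ s)) 1
    _ = 2 ^ s * ∏ i ∈ F, ∫⁻ y, f i y ∂μ := by
        rw [lintegral_const_mul _ hmeas, lintegral_pi_prod μ F hf]
    _ ≤ 2 ^ s * ∏ _i ∈ F, ENNReal.ofReal (Real.exp (-(p / 2))) := by
        gcongr with i hi
        exact hint i hi
    _ = _ := by
        rw [Finset.prod_const, ← ENNReal.ofReal_pow (Real.exp_pos _).le,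
          ENNReal.ofReal_mul (by positivity), ← Real.exp_nat_mul]
        congr 2
        · rw [ENNReal.ofReal_pow (by norm_num)]; simp
        · congr 1; ring

/-! ### Temporal paths -/

/-- The edges `{a, x₁}, {x₁, x₂}, …` traversed by the vertex sequence `a, x₁, …, xₖ`. -/
def pathEdges {V : Type*} : V → List V → List (Sym2 V)
  | _, [] => []
  | a, b :: l => s(a, b) :: pathEdges b l

theorem length_pathEdges {V : Type*} (a : V) (l : List V) :
    (pathEdges a l).length = l.length := by
  induction l generalizing a with
  | nil => rfl
  | cons b l ih => simp [pathEdges, ih]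

theorem SimpleGraph.Walk.exists_pathEdges {V : Type*} {G : SimpleGraph V} {u v : V}
    (p : G.Walk u v) :
    ∃ l : List V, p.support = u :: l ∧ p.edges = pathEdges u l ∧ l.getLastD u = v := by
  induction p with
  | nil => exact ⟨[], rfl, rfl, rfl⟩
  | @cons u w v h p ih =>
    obtain ⟨l, h1, h2, h3⟩ := ih
    exact ⟨w :: l, by simp [h1], by simp [h2, pathEdges], by rw [List.getLastD_cons, h3]⟩

namespace TemporalGraph

variable {V : Type*}

/-- A walk with non-decreasing time-stamps contains a temporal path. -/
theorem hasTemporalPath_of_walk {T : TemporalGraph V} {u v : V} (p : T.graph.Walk u v)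
    (hp : p.edges.Pairwise fun e f => T.stamp e ≤ T.stamp f) : T.HasTemporalPath u v := by
  classical
  exact ⟨p.bypass, p.bypass_isPath, hp.sublist p.edges_bypass_sublist_edges⟩

theorem HasTemporalPath.congr {T T' : TemporalGraph V} (hG : T.graph = T'.graph)
    (hs : ∀ e f, T.stamp e ≤ T.stamp f ↔ T'.stamp e ≤ T'.stamp f) {u v : V}
    (h : T.HasTemporalPath u v) : T'.HasTemporalPath u v := by
  obtain ⟨G, s⟩ := T
  obtain ⟨G', s'⟩ := T'
  obtain rfl : G = G' := hG
  obtain ⟨p, hp, hp'⟩ := h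
  exact ⟨p, hp, hp'.imp fun h => (hs _ _).1 h⟩

/-- There is a walk from `u` to `v` whose time-stamps are non-decreasing and at most `t`. -/
def ReachesBy (T : TemporalGraph V) (u v : V) (t : ℝ) : Prop :=
  ∃ p : T.graph.Walk u v, p.edges.Pairwise (fun e f => T.stamp e ≤ T.stamp f) ∧
    ∀ e ∈ p.edges, T.stamp e ≤ t

theorem ReachesBy.hasTemporalPath {T : TemporalGraph V} {u v : V} {t : ℝ}
    (h : T.ReachesBy u v t) : T.HasTemporalPath u v :=
  let ⟨p, hp, _⟩ := h
  hasTemporalPath_of_walk p hp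

theorem reachesBy_refl (T : TemporalGraph V) (u : V) (t : ℝ) : T.ReachesBy u u t :=
  ⟨.nil, by simp, by simp⟩

theorem ReachesBy.mono {T : TemporalGraph V} {u v : V} {t t' : ℝ} (h : T.ReachesBy u v t)
    (ht : t ≤ t') : T.ReachesBy u v t' :=
  let ⟨p, hp, hp'⟩ := h
  ⟨p, hp, fun e he => (hp' e he).trans ht⟩

theorem ReachesBy.step {T : TemporalGraph V} {u v w : V} {t t' : ℝ} (h : T.ReachesBy u v t)
    (hadj : T.graph.Adj v w) (h1 : t ≤ T.stamp s(v, w)) (h2 : T.stamp s(v, w) ≤ t') :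
    T.ReachesBy u w t' := by
  obtain ⟨p, hp, hp'⟩ := h
  refine ⟨p.concat hadj, ?_, ?_⟩
  · rw [SimpleGraph.Walk.edges_concat, List.concat_eq_append, List.pairwise_append]
    refine ⟨hp, by simp, fun e he f hf => ?_⟩
    rw [List.mem_singleton] at hf
    exact hf ▸ (hp' e he).trans h1
  · intro e he
    rw [SimpleGraph.Walk.edges_concat, List.concat_eq_append, List.mem_append,
      List.mem_singleton] at he
    obtain he | rfl := he
    · exact (hp' e he).trans (h1.trans h2)
    · exact h2

end TemporalGraph

/-! ### Measurability -/

instance : IsProbabilityMeasure (volume : Measure UnitAddCircle) :=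
  ⟨UnitAddCircle.measure_univ⟩

theorem measurable_torusDist {d : ℕ} :
    Measurable fun p : UnitAddTorus (Fin d) × UnitAddTorus (Fin d) => torusDist p.1 p.2 := by
  unfold torusDist
  fun_prop

/-- Temporal reachability is measurable, since it depends on the sample only through the adjacency
relation and the order of the time-stamps, for which there are finitely many possibilities. -/
theorem measurableSet_hasTemporalPath {d n : ℕ} {K : ℝ → ℝ} (hK : Measurable K) (r : ℝ)
    (u v : Fin n) :
    MeasurableSet {ω : TRGGSample d n | (temporalRGG K r ω).HasTemporalPath u v} := by
  let Φ : TRGGSample d n →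
      (Fin n → Fin n → Prop) × (Sym2 (Fin n) → Sym2 (Fin n) → Prop) := fun ω =>
    (fun a b => (temporalRGG K r ω).graph.Adj a b,
      fun e f => (temporalRGG K r ω).stamp e ≤ (temporalRGG K r ω).stamp f)
  have hΦ : Measurable Φ := by
    refine Measurable.prodMk ?_ ?_
    · refine measurable_pi_lambda _ fun a => measurable_pi_lambda _ fun b => ?_
      have h1 : Measurable fun ω : TRGGSample d n => (ω.2.1 s(a, b) : ℝ) := by fun_prop
      have h2 : Measurable fun ω : TRGGSample d n => K (torusDist (ω.1 a) (ω.1 b) / r) :=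
        hK.comp ((measurable_torusDist.comp
          (by fun_prop : Measurable fun ω : TRGGSample d n => (ω.1 a, ω.1 b))).div_const r)
      have h3 : MeasurableSet {ω : TRGGSample d n |
          (ω.2.1 s(a, b) : ℝ) < K (torusDist (ω.1 a) (ω.1 b) / r)} := measurableSet_lt h1 h2
      exact Measurable.and (measurable_const (a := a ≠ b)) (measurableSet_setOfPred.1 h3)
    · refine measurable_pi_lambda _ fun e => measurable_pi_lambda _ fun f => ?_
      have h1 : Measurable fun ω : TRGGSample d n => (ω.2.2 e : ℝ) := by fun_prop
      have h2 : Measurable fun ω : TRGGSample d n => (ω.2.2 f : ℝ) := by fun_prop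
      exact measurableSet_setOfPred.1 (measurableSet_le h1 h2)
  have hset : {ω : TRGGSample d n | (temporalRGG K r ω).HasTemporalPath u v} =
      Φ ⁻¹' (Φ '' {ω | (temporalRGG K r ω).HasTemporalPath u v}) := by
    refine (Set.subset_preimage_image _ _).antisymm ?_
    rintro ω ⟨ω', h, hω⟩
    rw [Prod.ext_iff] at hω
    refine h.congr ?_ ?_
    · ext a b
      exact iff_of_eq (congrFun (congrFun hω.1 a) b)
    · intro e f
      exact iff_of_eq (congrFun (congrFun hω.2 e) f)
  rw [hset]
  exact hΦ (Set.toFinite _).measurableSet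

theorem measurableSet_isTemporalSource {d n : ℕ} {K : ℝ → ℝ} (hK : Measurable K) (r : ℝ)
    (u : Fin n) :
    MeasurableSet {ω : TRGGSample d n | (temporalRGG K r ω).IsTemporalSource u} := by
  simp only [TemporalGraph.IsTemporalSource, Set.ofPred_forall]
  exact MeasurableSet.iInter fun v => measurableSet_hasTemporalPath hK r u v

theorem measurableSet_temporallyConnected {d n : ℕ} {K : ℝ → ℝ} (hK : Measurable K) (r : ℝ) :
    MeasurableSet {ω : TRGGSample d n | (temporalRGG K r ω).TemporallyConnected} := by
  simp only [TemporalGraph.TemporallyConnected, Set.ofPred_forall]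
  exact MeasurableSet.iInter fun u => measurableSet_isTemporalSource hK r u

/-! ### Exponential kernels -/

theorem lintegral_exp_neg_Ioi {c : ℝ} (hc : 0 < c) (a : ℝ) :
    ∫⁻ b in Set.Ioi a, ENNReal.ofReal (Real.exp (-(c * (b - a)))) = ENNReal.ofReal c⁻¹ := by
  have h1 : ∀ b, Real.exp (-(c * (b - a))) = Real.exp (c * a) * Real.exp (-c * b) := fun b => by
    rw [← Real.exp_add]; ring_nf
  simp only [h1]
  rw [← ofReal_integral_eq_lintegral_ofReal
    ((integrableOn_exp_mul_Ioi (neg_lt_zero.2 hc) a).const_mul _)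
    (ae_of_all _ fun b => by positivity), integral_const_mul,
    integral_exp_mul_Ioi (neg_lt_zero.2 hc)]
  congr 1
  rw [neg_div_neg_eq, ← mul_div_assoc, ← Real.exp_add]
  simp

theorem lintegral_exp_Iic {c : ℝ} (hc : 0 < c) :
    ∫⁻ b in Set.Iic (0 : ℝ), ENNReal.ofReal (Real.exp (c * b)) = ENNReal.ofReal c⁻¹ := by
  rw [← ofReal_integral_eq_lintegral_ofReal (integrableOn_exp_mul_Iic hc 0)
    (ae_of_all _ fun b => by positivity), integral_exp_mul_Iic hc]
  simp

/-- The kernel `1{a ≤ b} * exp (-c * (b - a))` on the unit interval. Its product along a sequence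
started at `0` dominates `exp (-c)` times the indicator of the sequence being non-decreasing. -/
noncomputable def expKernel (c : ℝ) (a b : unitInterval) : ℝ≥0∞ :=
  if a ≤ b then ENNReal.ofReal (Real.exp (-(c * (b - a : ℝ)))) else 0

theorem measurable_expKernel (c : ℝ) : Measurable (Function.uncurry (expKernel c)) := by
  refine Measurable.ite (measurableSet_le measurable_fst measurable_snd) ?_ measurable_const
  fun_prop

theorem lintegral_expKernel_le {c : ℝ} (hc : 0 < c) (a : unitInterval) :
    ∫⁻ b, expKernel c a b ≤ ENNReal.ofReal c⁻¹ := by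
  set f : ℝ → ℝ≥0∞ := (Set.Ici (a : ℝ)).indicator
    fun b => ENNReal.ofReal (Real.exp (-(c * (b - a)))) with hf
  have hfm : Measurable f := Measurable.indicator (by fun_prop) measurableSet_Ici
  have h1 : ∀ b : unitInterval, expKernel c a b = f b := by
    intro b
    simp only [expKernel, f, Set.indicator, Set.mem_Ici, Subtype.coe_le_coe]
  simp only [h1]
  rw [unitInterval.measurePreserving_coe.lintegral_comp hfm]
  calc ∫⁻ b in unitInterval, f b ≤ ∫⁻ b, f b := setLIntegral_le_lintegral _ _
    _ = _ := by
      rw [hf, lintegral_indicator measurableSet_Ici, setLIntegral_congr Ioi_ae_eq_Ici.symm,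
        lintegral_exp_neg_Ioi hc]

theorem exp_le_chainProd_expKernel {c : ℝ} (hc : 0 < c) {a : unitInterval}
    {l : List unitInterval} (h : (a :: l).Pairwise (· ≤ ·)) :
    ENNReal.ofReal (Real.exp (-(c * (1 - a : ℝ)))) ≤ chainProd (expKernel c) a l := by
  induction l generalizing a with
  | nil =>
    rw [chainProd, ← ENNReal.ofReal_one]
    refine ENNReal.ofReal_le_ofReal (Real.exp_le_one_iff.2 ?_)
    have := mul_nonneg hc.le (sub_nonneg.2 a.2.2)
    linarith
  | cons b l ih =>
    obtain ⟨h1, h2⟩ := List.pairwise_cons.1 h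
    rw [chainProd, expKernel, if_pos (h1 b (by simp))]
    refine le_trans (le_of_eq ?_) (mul_le_mul_right (ih h2) _)
    rw [← ENNReal.ofReal_mul (Real.exp_pos _).le, ← Real.exp_add]
    ring_nf

/-- Independent uniform time-stamps of `k` distinct edges are in order with probability at most
`exp c / c ^ k`, for every `c > 0`. -/
theorem volume_stamps_sorted_le {ι : Type*} [Fintype ι] {c : ℝ} (hc : 0 < c) {l : List ι}
    (hl : l.Nodup) :
    volume {t : ι → unitInterval | (l.map t).Pairwise (· ≤ ·)} ≤
      ENNReal.ofReal (Real.exp c) * ENNReal.ofReal c⁻¹ ^ l.length := by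
  classical
  have hm : Measurable fun t : ι → unitInterval =>
      ENNReal.ofReal (Real.exp c) * chainProd (expKernel c) 0 (l.map t) :=
    ((measurable_chainProd (measurable_expKernel c) l).comp
      (by fun_prop : Measurable fun t : ι → unitInterval => ((0 : unitInterval), t))).const_mul _
  calc volume {t : ι → unitInterval | (l.map t).Pairwise (· ≤ ·)}
      ≤ volume {t : ι → unitInterval |
          1 ≤ ENNReal.ofReal (Real.exp c) * chainProd (expKernel c) 0 (l.map t)} := by
        refine measure_mono fun t ht => ?_
        have h1 := exp_le_chainProd_expKernel hc (a := 0) (l := l.map t)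
          (List.pairwise_cons.2 ⟨fun b _ => unitInterval.nonneg', ht⟩)
        refine le_trans (le_of_eq ?_) (mul_le_mul_right h1 _)
        rw [← ENNReal.ofReal_mul (Real.exp_pos _).le, ← Real.exp_add]
        simp
    _ ≤ ∫⁻ t, ENNReal.ofReal (Real.exp c) * chainProd (expKernel c) 0 (l.map t)
          ∂(volume : Measure (ι → unitInterval)) := by
        simpa using mul_meas_ge_le_lintegral hm 1
    _ ≤ _ := by
        rw [lintegral_const_mul']
        · gcongr
          exact lintegral_chainProd_le volume (measurable_expKernel c)
            (lintegral_expKernel_le hc) hl 0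
        · exact ENNReal.ofReal_ne_top

theorem lintegral_exp_neg_norm_le {c : ℝ} (hc : 0 < c) (a : UnitAddCircle) :
    ∫⁻ y : UnitAddCircle, ENNReal.ofReal (Real.exp (-(c * ‖y - a‖))) ≤
      ENNReal.ofReal (2 / c) := by
  rw [lintegral_sub_right_eq_self
    (fun y : UnitAddCircle => ENNReal.ofReal (Real.exp (-(c * ‖y‖)))) a,
    ← UnitAddCircle.lintegral_preimage (-(1 / 2))]
  have h0 : ∀ y ∈ Set.Ioc (-(1 / 2) : ℝ) (-(1 / 2) + 1), ‖(y : UnitAddCircle)‖ = |y| := by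
    intro y hy
    rw [AddCircle.norm_coe_eq_abs_iff 1 one_ne_zero, abs_le]
    norm_num at hy ⊢
    exact ⟨hy.1.le, hy.2⟩
  calc ∫⁻ y in Set.Ioc (-(1 / 2) : ℝ) (-(1 / 2) + 1),
        ENNReal.ofReal (Real.exp (-(c * ‖(y : UnitAddCircle)‖)))
      = ∫⁻ y in Set.Ioc (-(1 / 2) : ℝ) (-(1 / 2) + 1),
        ENNReal.ofReal (Real.exp (-(c * |y|))) :=
        setLIntegral_congr_fun measurableSet_Ioc fun y hy => by rw [h0 y hy]
    _ ≤ ∫⁻ y in Set.Iic 0 ∪ Set.Ioi 0, ENNReal.ofReal (Real.exp (-(c * |y|))) :=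
        lintegral_mono_set (by simp [Set.Iic_union_Ioi])
    _ ≤ (∫⁻ y in Set.Iic 0, ENNReal.ofReal (Real.exp (-(c * |y|)))) +
        ∫⁻ y in Set.Ioi 0, ENNReal.ofReal (Real.exp (-(c * |y|))) := lintegral_union_le _ _ _
    _ = (∫⁻ y in Set.Iic (0 : ℝ), ENNReal.ofReal (Real.exp (c * y))) +
        ∫⁻ y in Set.Ioi (0 : ℝ), ENNReal.ofReal (Real.exp (-(c * (y - 0)))) := by
        congr 1
        · refine setLIntegral_congr_fun measurableSet_Iic fun y hy => ?_
          rw [abs_of_nonpos hy]; simp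
        · refine setLIntegral_congr_fun measurableSet_Ioi fun y hy => ?_
          rw [abs_of_pos hy]; simp
    _ = _ := by
        rw [lintegral_exp_Iic hc, lintegral_exp_neg_Ioi hc,
          ← ENNReal.ofReal_add (by positivity) (by positivity)]
        congr 1; ring

/-- The kernel `B * exp (-‖b - a‖ / ρ)` on the torus with its supremum norm. -/
noncomputable def decayKernel {d : ℕ} (B ρ : ℝ) (a b : UnitAddTorus (Fin d)) : ℝ≥0∞ :=
  ENNReal.ofReal (B * Real.exp (-(‖b - a‖ / ρ)))

theorem measurable_decayKernel {d : ℕ} (B ρ : ℝ) :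
    Measurable (Function.uncurry (decayKernel (d := d) B ρ)) := by
  unfold decayKernel Function.uncurry
  fun_prop

theorem lintegral_decayKernel_le {d : ℕ} (hd : 0 < d) {B ρ : ℝ} (hB : 0 ≤ B) (hρ : 0 < ρ)
    (a : UnitAddTorus (Fin d)) :
    ∫⁻ b, decayKernel B ρ a b ≤ ENNReal.ofReal (B * (2 * d * ρ) ^ d) := by
  have hd' : (0 : ℝ) < d := Nat.cast_pos.2 hd
  have hc : 0 < (d * ρ)⁻¹ := by positivity
  have key : ∀ b : UnitAddTorus (Fin d), decayKernel B ρ a b ≤ ENNReal.ofReal B *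
      ∏ i, ENNReal.ofReal (Real.exp (-((d * ρ)⁻¹ * ‖b i - a i‖))) := by
    intro b
    rw [decayKernel, ← ENNReal.ofReal_prod_of_nonneg (fun i _ => (Real.exp_pos _).le),
      ← Real.exp_sum, ← ENNReal.ofReal_mul hB]
    gcongr
    rw [Finset.sum_neg_distrib, neg_le_neg_iff, ← Finset.mul_sum]
    have h1 : ∑ i, ‖b i - a i‖ ≤ d * ‖b - a‖ := by
      calc ∑ i, ‖b i - a i‖ ≤ ∑ _i : Fin d, ‖b - a‖ :=
            Finset.sum_le_sum fun i _ => norm_le_pi_norm (b - a) i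
        _ = d * ‖b - a‖ := by simp
    calc (d * ρ)⁻¹ * ∑ i, ‖b i - a i‖ ≤ (d * ρ)⁻¹ * (d * ‖b - a‖) := by gcongr
      _ = ‖b - a‖ / ρ := by field_simp
  calc ∫⁻ b, decayKernel B ρ a b
      ≤ ∫⁻ b : UnitAddTorus (Fin d), ENNReal.ofReal B *
        ∏ i, ENNReal.ofReal (Real.exp (-((d * ρ)⁻¹ * ‖b i - a i‖))) := lintegral_mono key
    _ = ENNReal.ofReal B * ∏ i : Fin d, ∫⁻ y : UnitAddCircle,
        ENNReal.ofReal (Real.exp (-((d * ρ)⁻¹ * ‖y - a i‖))) := by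
        rw [lintegral_const_mul' _ _ ENNReal.ofReal_ne_top]
        congr 1
        exact lintegral_pi_prod volume Finset.univ
          (f := fun (i : Fin d) (y : UnitAddCircle) =>
            ENNReal.ofReal (Real.exp (-((d * ρ)⁻¹ * ‖y - a i‖)))) (fun i => by fun_prop)
    _ ≤ ENNReal.ofReal B * ∏ _i : Fin d, ENNReal.ofReal (2 / (d * ρ)⁻¹) := by
        gcongr with i
        exact lintegral_exp_neg_norm_le hc _
    _ = _ := by
        rw [Finset.prod_const, Finset.card_univ, Fintype.card_fin, ENNReal.ofReal_mul hB,
          ← ENNReal.ofReal_pow (by positivity)]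
        congr 3
        field_simp

/-- Half of the decay of the kernel pays for the distance between the two ends of the chain. -/
theorem chainProd_decayKernel_le {d : ℕ} {B r : ℝ} (hr : 0 < r)
    (a : UnitAddTorus (Fin d)) (l : List (UnitAddTorus (Fin d))) :
    chainProd (decayKernel B r) a l ≤
      ENNReal.ofReal (Real.exp (-(‖l.getLastD a - a‖ / (2 * r)))) *
        chainProd (decayKernel B (2 * r)) a l := by
  induction l generalizing a with
  | nil => simp [chainProd]
  | cons b l ih =>
    rw [chainProd, chainProd, List.getLastD_cons]
    have h1 : decayKernel B r a b =
        ENNReal.ofReal (Real.exp (-(‖b - a‖ / (2 * r)))) * decayKernel B (2 * r) a b := by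
      rw [decayKernel, decayKernel, ← ENNReal.ofReal_mul (Real.exp_pos _).le]
      congr 1
      rw [mul_left_comm, ← Real.exp_add]
      congr 2
      field_simp
      ring
    have h2 : ENNReal.ofReal (Real.exp (-(‖b - a‖ / (2 * r)))) *
        ENNReal.ofReal (Real.exp (-(‖l.getLastD b - b‖ / (2 * r)))) ≤
        ENNReal.ofReal (Real.exp (-(‖l.getLastD b - a‖ / (2 * r)))) := by
      rw [← ENNReal.ofReal_mul (Real.exp_pos _).le, ← Real.exp_add]
      gcongr
      rw [← neg_add, neg_le_neg_iff, ← add_div]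
      gcongr
      calc ‖l.getLastD b - a‖ = ‖(b - a) + (l.getLastD b - b)‖ := by congr 1; abel
        _ ≤ _ := norm_add_le _ _
    calc decayKernel B r a b * chainProd (decayKernel B r) b l
        ≤ (ENNReal.ofReal (Real.exp (-(‖b - a‖ / (2 * r)))) * decayKernel B (2 * r) a b) *
          (ENNReal.ofReal (Real.exp (-(‖l.getLastD b - b‖ / (2 * r)))) *
            chainProd (decayKernel B (2 * r)) b l) := by
          rw [h1]; gcongr; exact ih b
      _ = (ENNReal.ofReal (Real.exp (-(‖b - a‖ / (2 * r)))) *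
          ENNReal.ofReal (Real.exp (-(‖l.getLastD b - b‖ / (2 * r))))) *
          (decayKernel B (2 * r) a b * chainProd (decayKernel B (2 * r)) b l) := by ring
      _ ≤ _ := by gcongr

theorem norm_sub_le_torusDist {d : ℕ} (x y : UnitAddTorus (Fin d)) :
    ‖x - y‖ ≤ torusDist x y := by
  refine (pi_norm_le_iff_of_nonneg (Real.sqrt_nonneg _)).2 fun i => Real.le_sqrt_of_sq_le ?_
  exact Finset.single_le_sum (f := fun i => ‖x i - y i‖ ^ 2) (fun i _ => sq_nonneg _)
    (Finset.mem_univ i)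

theorem torusDist_comm {d : ℕ} (x y : UnitAddTorus (Fin d)) : torusDist x y = torusDist y x := by
  simp only [torusDist, norm_sub_rev]

/-- The super-exponential bound on the connection function is used only through exponential
decay. -/
theorem connection_le_exp {d : ℕ} {β : ℝ} (hβ : 0 < β) {K : ℝ → ℝ}
    (hK1 : ∀ x : ℝ, 0 ≤ x → 0 ≤ K x ∧ K x ≤ 1)
    (hK2 : ∀ x : ℝ, 1 < x → K x ≤ β * (x ^ d)⁻¹ * Real.exp (-((x + 1) * Real.log (x + 1))))
    {x : ℝ} (hx : 0 ≤ x) : K x ≤ max β (Real.exp 1) * Real.exp (-x) := by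
  rcases le_or_gt x 1 with h | h
  · calc K x ≤ 1 := (hK1 x hx).2
      _ ≤ Real.exp 1 * Real.exp (-x) := by
        rw [← Real.exp_add]; exact Real.one_le_exp (by linarith)
      _ ≤ _ := by gcongr; exact le_max_right _ _
  · have hlog : x ≤ (x + 1) * Real.log (x + 1) := by
      have h1 := Real.one_sub_inv_le_log_of_pos (show 0 < x + 1 by linarith)
      calc x = (x + 1) * (1 - (x + 1)⁻¹) := by field_simp; ring
        _ ≤ _ := by gcongr
    have hpow : (x ^ d)⁻¹ ≤ 1 := inv_le_one_of_one_le₀ (one_le_pow₀ h.le)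
    calc K x ≤ β * (x ^ d)⁻¹ * Real.exp (-((x + 1) * Real.log (x + 1))) := hK2 x h
      _ ≤ β * 1 * Real.exp (-x) := by gcongr
      _ ≤ _ := by rw [mul_one]; gcongr; exact le_max_left _ _

/-! ### Below the threshold -/

/-- The connection probability of an unordered pair of vertices at the positions `x`. -/
noncomputable def edgeProb {d n : ℕ} (K : ℝ → ℝ) (r : ℝ) (x : Fin n → UnitAddTorus (Fin d)) :
    Sym2 (Fin n) → ℝ :=
  Sym2.lift ⟨fun a b => K (torusDist (x a) (x b) / r), fun a b =>
    congrArg (fun t => K (t / r)) (torusDist_comm (x a) (x b))⟩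

theorem unitInterval_volume_lt_le (c : ℝ) :
    volume {y : unitInterval | (y : ℝ) < c} ≤ ENNReal.ofReal c := by
  rw [unitInterval.volume_apply]
  calc volume (Subtype.val '' {y : unitInterval | (y : ℝ) < c}) ≤ volume (Set.Ico 0 c) := by
        refine measure_mono ?_
        rintro _ ⟨y, hy, rfl⟩
        exact ⟨y.2.1, hy⟩
    _ = _ := by rw [Real.volume_Ico, sub_zero]

theorem volume_marks_lt_le {ι : Type*} [Fintype ι] (thr : ι → ℝ) {l : List ι} (hl : l.Nodup) :
    volume {m : ι → unitInterval | ∀ e ∈ l, (m e : ℝ) < thr e} ≤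
      (l.map fun e => ENNReal.ofReal (thr e)).prod := by
  classical
  have h := pi_forall_mem_le (volume : Measure unitInterval) l.toFinset
    (fun e => {y : unitInterval | (y : ℝ) < thr e})
  simp only [List.mem_toFinset, Set.mem_ofPred_eq] at h
  refine h.trans ?_
  rw [← List.prod_toFinset _ hl]
  exact Finset.prod_le_prod' fun e _ => unitInterval_volume_lt_le _

theorem prod_edgeProb_le_chainProd {d n : ℕ} {K : ℝ → ℝ} {B r : ℝ} (hB : 0 ≤ B) (hr : 0 < r)
    (hK : ∀ t, 0 ≤ t → K t ≤ B * Real.exp (-t)) (x : Fin n → UnitAddTorus (Fin d))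
    (a : Fin n) (l : List (Fin n)) :
    ((pathEdges a l).map fun e => ENNReal.ofReal (edgeProb K r x e)).prod ≤
      chainProd (decayKernel B r) (x a) (l.map x) := by
  induction l generalizing a with
  | nil => simp [pathEdges, chainProd]
  | cons b l ih =>
    rw [pathEdges, List.map_cons, List.prod_cons, List.map_cons, chainProd]
    refine mul_le_mul' (ENNReal.ofReal_le_ofReal ?_) (ih b)
    calc edgeProb K r x s(a, b) = K (torusDist (x a) (x b) / r) := rfl
      _ ≤ B * Real.exp (-(torusDist (x a) (x b) / r)) :=
        hK _ (div_nonneg (Real.sqrt_nonneg _) hr.le)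
      _ ≤ _ := by
        gcongr
        rw [norm_sub_rev]
        exact norm_sub_le_torusDist _ _

/-- Given positions at which the path `u, l` spans a distance at least `1 / 8`, the path is a
temporal path of the graph with at most this probability. -/
theorem volume_temporal_path_le {d n : ℕ} {K : ℝ → ℝ} {B r c : ℝ} (hB : 0 ≤ B) (hr : 0 < r)
    (hc : 0 < c) (hK : ∀ t, 0 ≤ t → K t ≤ B * Real.exp (-t))
    (x : Fin n → UnitAddTorus (Fin d)) (u : Fin n) {l : List (Fin n)}
    (hl : (pathEdges u l).Nodup) (hfar : 1 / 8 ≤ ‖x (l.getLastD u) - x u‖) :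
    volume {y : (Sym2 (Fin n) → unitInterval) × (Sym2 (Fin n) → unitInterval) |
        (∀ e ∈ pathEdges u l, (y.1 e : ℝ) < edgeProb K r x e) ∧
        ((pathEdges u l).map y.2).Pairwise (· ≤ ·)} ≤
      ENNReal.ofReal (Real.exp (c - 1 / (16 * r))) * ENNReal.ofReal c⁻¹ ^ l.length *
        chainProd (decayKernel B (2 * r)) (x u) (l.map x) := by
  have hprod : {y : (Sym2 (Fin n) → unitInterval) × (Sym2 (Fin n) → unitInterval) |
        (∀ e ∈ pathEdges u l, (y.1 e : ℝ) < edgeProb K r x e) ∧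
        ((pathEdges u l).map y.2).Pairwise (· ≤ ·)} =
      {m : Sym2 (Fin n) → unitInterval | ∀ e ∈ pathEdges u l, (m e : ℝ) < edgeProb K r x e} ×ˢ
      {t : Sym2 (Fin n) → unitInterval | ((pathEdges u l).map t).Pairwise (· ≤ ·)} := rfl
  rw [hprod, Measure.volume_eq_prod, Measure.prod_prod]
  have h1 := (volume_marks_lt_le (edgeProb K r x) hl).trans
    ((prod_edgeProb_le_chainProd hB hr hK x u l).trans (chainProd_decayKernel_le hr _ _))
  have h2 := volume_stamps_sorted_le hc hl
  rw [length_pathEdges] at h2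
  rw [List.getLastD_map] at h1
  have h3 : ENNReal.ofReal (Real.exp (-(‖x (l.getLastD u) - x u‖ / (2 * r)))) ≤
      ENNReal.ofReal (Real.exp (-(1 / (16 * r)))) := by
    refine ENNReal.ofReal_le_ofReal (Real.exp_le_exp.2 (neg_le_neg ?_))
    calc 1 / (16 * r) = 1 / 8 / (2 * r) := by field_simp; norm_num
      _ ≤ _ := by gcongr
  calc _ ≤ (ENNReal.ofReal (Real.exp (-(1 / (16 * r)))) *
          chainProd (decayKernel B (2 * r)) (x u) (l.map x)) *
        (ENNReal.ofReal (Real.exp c) * ENNReal.ofReal c⁻¹ ^ l.length) := by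
        refine mul_le_mul' (h1.trans ?_) h2
        gcongr
    _ = _ := by
        rw [sub_eq_add_neg, Real.exp_add, ENNReal.ofReal_mul (Real.exp_pos _).le]
        ring

/-- Given positions at which some vertex is at distance at least `1 / 8` from `u`, a union bound over
the self-avoiding vertex sequences from `u`, sorted by their number `k` of edges. -/
theorem volume_slice_source_le {d n : ℕ} {K : ℝ → ℝ} {B r c : ℝ} (hB : 0 ≤ B) (hr : 0 < r)
    (hc : 0 < c) (hK : ∀ t, 0 ≤ t → K t ≤ B * Real.exp (-t))
    (x : Fin n → UnitAddTorus (Fin d)) (u : Fin n) (hfar : ∃ v, 1 / 8 ≤ ‖x v - x u‖) :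
    volume {y : (Sym2 (Fin n) → unitInterval) × (Sym2 (Fin n) → unitInterval) |
        (temporalRGG K r (x, y)).IsTemporalSource u} ≤
      ∑' k : ℕ, ∑ l : List.Vector (Fin n) k, if (u :: l.1).Nodup then
        ENNReal.ofReal (Real.exp (c - 1 / (16 * r))) * ENNReal.ofReal c⁻¹ ^ k *
          chainProd (decayKernel B (2 * r)) (x u) (l.1.map x) else 0 := by
  obtain ⟨v, hv⟩ := hfar
  let S : List (Fin n) → Set ((Sym2 (Fin n) → unitInterval) × (Sym2 (Fin n) → unitInterval)) :=
    fun l => {y | ((u :: l).Nodup ∧ (pathEdges u l).Nodup ∧ l.getLastD u = v) ∧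
      (∀ e ∈ pathEdges u l, (y.1 e : ℝ) < edgeProb K r x e) ∧
        ((pathEdges u l).map y.2).Pairwise (· ≤ ·)}
  have hsub : {y : (Sym2 (Fin n) → unitInterval) × (Sym2 (Fin n) → unitInterval) |
      (temporalRGG K r (x, y)).IsTemporalSource u} ⊆
      ⋃ k : ℕ, ⋃ l : List.Vector (Fin n) k, S l.1 := by
    intro y hy
    obtain ⟨p, hp, hsort⟩ := hy v
    obtain ⟨l, h1, h2, h3⟩ := p.exists_pathEdges
    refine Set.mem_iUnion₂.2 ⟨l.length, ⟨l, rfl⟩, ⟨h1 ▸ hp.support_nodup, ?_, h3⟩, ?_, ?_⟩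
    · exact h2 ▸ hp.isTrail.edges_nodup
    · intro e he
      have hadj := p.edges_subset_edgeSet (h2 ▸ he)
      induction e with
      | h a b => exact hadj.2
    · rw [List.pairwise_map]
      exact h2 ▸ hsort
  refine (measure_mono hsub).trans ((measure_iUnion_le _).trans (ENNReal.tsum_le_tsum fun k => ?_))
  refine (measure_iUnion_le _).trans (le_of_eq_of_le (tsum_fintype _) ?_)
  refine Finset.sum_le_sum fun l _ => ?_
  by_cases hl : (u :: l.1).Nodup ∧ (pathEdges u l.1).Nodup ∧ l.1.getLastD u = v
  · rw [if_pos hl.1]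
    have := volume_temporal_path_le hB hr hc hK x u hl.2.1 (hl.2.2.symm ▸ hv)
    rw [l.2] at this
    refine (measure_mono ?_).trans this
    exact fun y hy => hy.2
  · have : S l.1 = ∅ := Set.eq_empty_of_forall_notMem fun y hy => hl hy.1
    rw [this, measure_empty]
    exact zero_le

/-- First moment bound: the expected number of temporal paths from `u` that span a distance at
least `1 / 8`. -/
theorem volume_source_far_le {d n : ℕ} (hd : 0 < d) (hn : 0 < n) {K : ℝ → ℝ}
    (hKm : Measurable K) {B r : ℝ} (hB : 0 < B) (hr : 0 < r)
    (hK : ∀ t, 0 ≤ t → K t ≤ B * Real.exp (-t)) (u : Fin n) :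
    volume {ω : TRGGSample d n | (temporalRGG K r ω).IsTemporalSource u ∧
        ∃ v, 1 / 8 ≤ ‖ω.1 v - ω.1 u‖} ≤
      ENNReal.ofReal (2 * Real.exp (2 * (n * (B * (4 * d * r) ^ d)) - 1 / (16 * r))) := by
  have hd' : (0 : ℝ) < d := Nat.cast_pos.2 hd
  have hn' : (0 : ℝ) < n := Nat.cast_pos.2 hn
  set Γ : ℝ := B * (4 * d * r) ^ d with hΓ
  have hΓ0 : 0 < Γ := by positivity
  -- this choice of the exponential parameter makes the sum over path lengths geometric
  set c : ℝ := 2 * (n * Γ) with hc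
  have hc0 : 0 < c := by positivity
  have hmeas : MeasurableSet {ω : TRGGSample d n | (temporalRGG K r ω).IsTemporalSource u ∧
        ∃ v, 1 / 8 ≤ ‖ω.1 v - ω.1 u‖} := by
    have h : MeasurableSet {ω : TRGGSample d n | ∃ v, 1 / 8 ≤ ‖ω.1 v - ω.1 u‖} := by
      simp only [Set.ofPred_exists]
      exact MeasurableSet.iUnion fun v => measurableSet_le measurable_const (by fun_prop)
    exact (measurableSet_isTemporalSource hKm r u).inter h
  have hchain : ∀ l : List (Fin n), Measurable fun x : Fin n → UnitAddTorus (Fin d) =>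
      chainProd (decayKernel B (2 * r)) (x u) (l.map x) := fun l =>
    (measurable_chainProd (measurable_decayKernel B (2 * r)) l).comp
      (by fun_prop : Measurable fun x : Fin n → UnitAddTorus (Fin d) => (x u, x))
  set A : ℝ≥0∞ := ENNReal.ofReal (Real.exp (c - 1 / (16 * r))) with hA
  have hterm : ∀ (k : ℕ) (l : List.Vector (Fin n) k), Measurable
      fun x : Fin n → UnitAddTorus (Fin d) => if (u :: l.1).Nodup then
        A * ENNReal.ofReal c⁻¹ ^ k *
          chainProd (decayKernel B (2 * r)) (x u) (l.1.map x) else 0 := by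
    intro k l
    split_ifs
    · exact (hchain l.1).const_mul _
    · exact measurable_const
  rw [Measure.volume_eq_prod, Measure.prod_apply hmeas]
  calc _ ≤ ∫⁻ x : Fin n → UnitAddTorus (Fin d), ∑' k : ℕ, ∑ l : List.Vector (Fin n) k,
          if (u :: l.1).Nodup then A * ENNReal.ofReal c⁻¹ ^ k *
            chainProd (decayKernel B (2 * r)) (x u) (l.1.map x) else 0 := by
        refine lintegral_mono fun x => ?_
        by_cases hfar : ∃ v, 1 / 8 ≤ ‖x v - x u‖
        · refine le_trans (measure_mono ?_)
            (volume_slice_source_le hB.le hr hc0 hK x u hfar)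
          exact fun y hy => hy.1
        · refine le_of_eq_of_le ?_ zero_le
          refine (measure_mono_null (t := ∅) ?_ measure_empty)
          exact fun y hy => hfar hy.2
    _ = ∑' k : ℕ, ∑ l : List.Vector (Fin n) k, ∫⁻ x : Fin n → UnitAddTorus (Fin d),
          if (u :: l.1).Nodup then A * ENNReal.ofReal c⁻¹ ^ k *
            chainProd (decayKernel B (2 * r)) (x u) (l.1.map x) else 0 := by
        rw [lintegral_tsum fun k =>
          (Finset.measurable_sum _ fun l _ => hterm k l).aemeasurable]
        exact tsum_congr fun k => lintegral_finsetSum _ fun l _ => hterm k l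
    _ ≤ ∑' k : ℕ, ∑ _l : List.Vector (Fin n) k,
          A * ENNReal.ofReal c⁻¹ ^ k * ENNReal.ofReal Γ ^ k := by
        refine ENNReal.tsum_le_tsum fun k => Finset.sum_le_sum fun l _ => ?_
        split_ifs with hl
        · rw [lintegral_const_mul _ (hchain l.1)]
          gcongr
          have h := lintegral_chainProd_start_le (volume : Measure (UnitAddTorus (Fin d)))
            (measurable_decayKernel B (2 * r))
            (lintegral_decayKernel_le hd hB.le (by positivity : 0 < 2 * r)) hl
          rw [l.2, show B * (2 * d * (2 * r)) ^ d = Γ by rw [hΓ]; ring_nf] at h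
          exact h
        · simp
    _ = ∑' k : ℕ, A * (2⁻¹ : ℝ≥0∞) ^ k := by
        refine tsum_congr fun k => ?_
        rw [Finset.sum_const, Finset.card_univ, card_vector, Fintype.card_fin, nsmul_eq_mul]
        have h2 : ((n : ℝ≥0∞) * ENNReal.ofReal c⁻¹ * ENNReal.ofReal Γ) = 2⁻¹ := by
          rw [← ENNReal.ofReal_natCast n, ← ENNReal.ofReal_mul (by positivity),
            ← ENNReal.ofReal_mul (by positivity),
            show (n : ℝ) * c⁻¹ * Γ = 2⁻¹ by rw [hc]; field_simp,
            ENNReal.ofReal_inv_of_pos two_pos]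
          simp
        rw [← h2, mul_pow, mul_pow]
        push_cast
        ring
    _ = _ := by
        rw [ENNReal.tsum_mul_left, ENNReal.tsum_geometric, ENNReal.one_sub_inv_two, inv_inv,
          ENNReal.ofReal_mul (by norm_num), mul_comm]
        simp [hA]

theorem volume_torus_near_le {d : ℕ} (hd : 0 < d) (a : UnitAddTorus (Fin d)) :
    volume {b | ‖b - a‖ < 1 / 4} ≤ 2⁻¹ := by
  have h1 : {b : UnitAddTorus (Fin d) | ‖b - a‖ < 1 / 4} ⊆
      Set.univ.pi fun i => Metric.closedBall (a i) (1 / 4) := by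
    intro b hb i _
    rw [Metric.mem_closedBall, dist_eq_norm]
    exact (norm_le_pi_norm (b - a) i).trans (le_of_lt hb)
  refine (measure_mono h1).trans ?_
  rw [volume_pi_pi]
  simp only [AddCircle.volume_closedBall]
  rw [Finset.prod_const, Finset.card_univ, Fintype.card_fin]
  have h2 : ENNReal.ofReal (min 1 (2 * (1 / 4))) = 2⁻¹ := by
    rw [show min (1 : ℝ) (2 * (1 / 4)) = 2⁻¹ by norm_num, ENNReal.ofReal_inv_of_pos two_pos]
    simp
  rw [h2]
  exact pow_le_of_le_one zero_le (by simp) hd.ne'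

/-- If all positions are within `1 / 4` of each other, then in particular consecutive ones are, which
turns the bound into a chain integral. -/
theorem volume_positions_near_le {d : ℕ} (hd : 0 < d) (m : ℕ) :
    volume {x : Fin (m + 1) → UnitAddTorus (Fin d) | ∀ v w, ‖x v - x w‖ < 1 / 4} ≤ 2⁻¹ ^ m := by
  let g : UnitAddTorus (Fin d) → UnitAddTorus (Fin d) → ℝ≥0∞ := fun a b =>
    {b | ‖b - a‖ < 1 / 4}.indicator 1 b
  have hg : Measurable (Function.uncurry g) := by
    have : Function.uncurry g =
        {p : UnitAddTorus (Fin d) × UnitAddTorus (Fin d) | ‖p.2 - p.1‖ < 1 / 4}.indicator 1 := by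
      funext p
      simp [g, Function.uncurry, Set.indicator]
    rw [this]
    exact measurable_one.indicator (measurableSet_lt (by fun_prop) measurable_const)
  have hC : ∀ a, ∫⁻ b, g a b ≤ 2⁻¹ := by
    intro a
    rw [lintegral_indicator_one (measurableSet_lt (by fun_prop) measurable_const)]
    exact volume_torus_near_le hd a
  have hnodup : ((0 : Fin (m + 1)) :: (List.finRange m).map Fin.succ).Nodup := by
    rw [← List.finRange_succ]
    exact List.nodup_finRange _
  have hone : ∀ x : Fin (m + 1) → UnitAddTorus (Fin d), (∀ v w, ‖x v - x w‖ < 1 / 4) →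
      ∀ (l : List (Fin (m + 1))) (a : Fin (m + 1)), chainProd g (x a) (l.map x) = 1 := by
    intro x hx l
    induction l with
    | nil => exact fun _ => rfl
    | cons b l ih =>
      intro a
      rw [List.map_cons, chainProd, ih b, mul_one]
      exact Set.indicator_of_mem (s := {y | ‖y - x a‖ < 1 / 4}) (hx b a)
        (1 : UnitAddTorus (Fin d) → ℝ≥0∞)
  have hmeas : Measurable fun x : Fin (m + 1) → UnitAddTorus (Fin d) =>
      chainProd g (x 0) (((List.finRange m).map Fin.succ).map x) :=
    (measurable_chainProd hg _).comp
      (by fun_prop : Measurable fun x : Fin (m + 1) → UnitAddTorus (Fin d) => (x 0, x))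
  calc volume {x : Fin (m + 1) → UnitAddTorus (Fin d) | ∀ v w, ‖x v - x w‖ < 1 / 4}
      ≤ volume {x : Fin (m + 1) → UnitAddTorus (Fin d) |
          1 ≤ chainProd g (x 0) (((List.finRange m).map Fin.succ).map x)} :=
        measure_mono fun x hx => (hone x hx _ _).ge
    _ ≤ ∫⁻ x : Fin (m + 1) → UnitAddTorus (Fin d),
          chainProd g (x 0) (((List.finRange m).map Fin.succ).map x) := by
        simpa using mul_meas_ge_le_lintegral hmeas 1
    _ ≤ 2⁻¹ ^ m := by
        have h := lintegral_chainProd_start_le (volume : Measure (UnitAddTorus (Fin d)))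
          hg hC hnodup
        rwa [List.length_map, List.length_finRange] at h

/-- Either all vertices are within `1 / 4` of each other, or every vertex, in particular the source,
has some vertex at distance at least `1 / 8`. -/
theorem volume_exists_source_le {d n : ℕ} (hd : 0 < d) (hn : 0 < n) {K : ℝ → ℝ}
    (hKm : Measurable K) {B r : ℝ} (hB : 0 < B) (hr : 0 < r)
    (hK : ∀ t, 0 ≤ t → K t ≤ B * Real.exp (-t)) :
    volume {ω : TRGGSample d n | ∃ u, (temporalRGG K r ω).IsTemporalSource u} ≤
      2⁻¹ ^ (n - 1) + ENNReal.ofReal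
        (n * (2 * Real.exp (2 * (n * (B * (4 * d * r) ^ d)) - 1 / (16 * r)))) := by
  have hsub : {ω : TRGGSample d n | ∃ u, (temporalRGG K r ω).IsTemporalSource u} ⊆
      ({x : Fin n → UnitAddTorus (Fin d) | ∀ v w, ‖x v - x w‖ < 1 / 4} ×ˢ Set.univ) ∪
      ⋃ u : Fin n, {ω : TRGGSample d n | (temporalRGG K r ω).IsTemporalSource u ∧
        ∃ v, 1 / 8 ≤ ‖ω.1 v - ω.1 u‖} := by
    rintro ω ⟨u, hu⟩
    by_cases hfar : ∃ v, 1 / 8 ≤ ‖ω.1 v - ω.1 u‖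
    · exact Or.inr (Set.mem_iUnion.2 ⟨u, hu, hfar⟩)
    · push Not at hfar
      refine Or.inl ⟨fun v w => ?_, trivial⟩
      calc ‖ω.1 v - ω.1 w‖ = ‖(ω.1 v - ω.1 u) - (ω.1 w - ω.1 u)‖ := by congr 1; abel
        _ ≤ ‖ω.1 v - ω.1 u‖ + ‖ω.1 w - ω.1 u‖ := norm_sub_le _ _
        _ < 1 / 4 := by linarith [hfar v, hfar w]
  refine (measure_mono hsub).trans ((measure_union_le _ _).trans (add_le_add ?_ ?_))
  · rw [Measure.volume_eq_prod, Measure.prod_prod, measure_univ, mul_one]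
    obtain ⟨m, rfl⟩ : ∃ m, n = m + 1 := ⟨n - 1, by omega⟩
    exact volume_positions_near_le hd m
  · refine (measure_iUnion_le _).trans (le_of_eq_of_le (tsum_fintype _) ?_)
    calc _ ≤ ∑ _u : Fin n, ENNReal.ofReal
          (2 * Real.exp (2 * (n * (B * (4 * d * r) ^ d)) - 1 / (16 * r))) :=
          Finset.sum_le_sum fun u _ => volume_source_far_le hd hn hKm hB hr hK u
      _ = _ := by
          rw [Finset.sum_const, Finset.card_univ, Fintype.card_fin, nsmul_eq_mul,
            ENNReal.ofReal_mul (Nat.cast_nonneg n), ENNReal.ofReal_natCast]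

/-! ### Asymptotics -/

/-- The scale `n ^ (1 / (d + 1))`, the order of the number of hops across the torus at the
threshold. -/
noncomputable def hopScale (d n : ℕ) : ℝ := (n : ℝ) ^ (1 / ((d : ℝ) + 1))

theorem hopScale_pow (d n : ℕ) : hopScale d n ^ (d + 1) = n := by
  rw [hopScale, ← Real.rpow_natCast, ← Real.rpow_mul (Nat.cast_nonneg n)]
  push_cast
  rw [one_div_mul_cancel (by positivity), Real.rpow_one]

theorem hopScale_pos {d n : ℕ} (hn : 0 < n) : 0 < hopScale d n :=
  Real.rpow_pos_of_pos (Nat.cast_pos.2 hn) _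

theorem rpow_neg_eq_inv_hopScale (d n : ℕ) :
    (n : ℝ) ^ (-(1 / ((d : ℝ) + 1))) = (hopScale d n)⁻¹ :=
  Real.rpow_neg (Nat.cast_nonneg n) _

theorem tendsto_hopScale (d : ℕ) : Tendsto (hopScale d) atTop atTop :=
  (tendsto_rpow_atTop (by positivity)).comp tendsto_natCast_atTop_atTop

theorem tendsto_hopScale_pow_mul_exp_neg (d p : ℕ) (A : ℝ) {b : ℝ} (hb : 0 < b) :
    Tendsto (fun n : ℕ => ENNReal.ofReal (A * hopScale d n ^ p * Real.exp (-(b * hopScale d n))))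
      atTop (𝓝 0) := by
  have h1 : Tendsto (fun x : ℝ => A / b ^ p * ((b * x) ^ p * Real.exp (-(b * x)))) atTop (𝓝 0) := by
    simpa using ((Real.tendsto_pow_mul_exp_neg_atTop_nhds_zero p).comp
      (tendsto_id.const_mul_atTop hb)).const_mul (A / b ^ p)
  have h2 : ∀ x : ℝ, A / b ^ p * ((b * x) ^ p * Real.exp (-(b * x))) =
      A * x ^ p * Real.exp (-(b * x)) := fun x => by
    rw [mul_pow]; field_simp
  simp only [h2] at h1
  simpa using ENNReal.tendsto_ofReal (h1.comp (tendsto_hopScale d))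

/-- The sets need not be measurable: subadditivity of the outer measure suffices. -/
theorem tendsto_volume_one_of_compl {Ω : ℕ → Type*} [∀ n, MeasureSpace (Ω n)]
    [∀ n, IsProbabilityMeasure (volume : Measure (Ω n))] {A : ∀ n, Set (Ω n)} {f : ℕ → ℝ≥0∞}
    (hf : Tendsto f atTop (𝓝 0)) (hA : ∀ᶠ n in atTop, volume (A n)ᶜ ≤ f n) :
    Tendsto (fun n => volume (A n)) atTop (𝓝 1) := by
  have h1 : Tendsto (fun n => 1 - f n) atTop (𝓝 1) := by
    simpa using ENNReal.Tendsto.sub (tendsto_const_nhds (x := (1 : ℝ≥0∞))) hf (by simp)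
  refine tendsto_of_tendsto_of_tendsto_of_le_of_le' h1 tendsto_const_nhds ?_
    (Eventually.of_forall fun n => prob_le_one)
  filter_upwards [hA] with n hn
  rw [tsub_le_iff_right, ← measure_univ (μ := (volume : Measure (Ω n))),
    ← Set.union_compl_self (A n)]
  exact (measure_union_le _ _).trans (by gcongr)

/-- As `(r * L) ^ (d + 1) = n * r ^ (d + 1)` for `L = hopScale d n`, the expected number of hops
`n * r ^ d` per unit of time is at most `c / r`, small compared with `1 / r`. -/
theorem first_moment_exponent_le {d n : ℕ} (hn : 0 < n) {B c r : ℝ} (hB : 0 < B) (hr : 0 < r)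
    (hd : 0 < d) (hc1 : c ≤ 1) (hc2 : c ≤ 1 / (64 * (B * (4 * d) ^ d)))
    (hrc : r ≤ c * (hopScale d n)⁻¹) :
    2 * (n * (B * (4 * d * r) ^ d)) - 1 / (16 * r) ≤ -(1 / 32 * hopScale d n) := by
  have hd' : (0 : ℝ) < d := Nat.cast_pos.2 hd
  set L := hopScale d n
  have hL : 0 < L := hopScale_pos hn
  have hrL : r * L ≤ c := by rwa [← le_div_iff₀ hL, div_eq_mul_inv]
  have hrL0 : 0 < r * L := by positivity
  have h1 : n * r ^ d ≤ c / r := by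
    rw [le_div_iff₀ hr]
    calc n * r ^ d * r = (r * L) ^ (d + 1) := by rw [mul_pow, hopScale_pow]; ring
      _ ≤ (r * L) ^ 1 := pow_le_pow_of_le_one hrL0.le (hrL.trans hc1) (by omega)
      _ ≤ c := by rwa [pow_one]
  set Γ := B * (4 * d) ^ d with hΓ
  have hΓ0 : 0 < Γ := by positivity
  have h2 : 2 * (n * (B * (4 * d * r) ^ d)) ≤ 1 / (32 * r) := by
    calc 2 * (n * (B * (4 * d * r) ^ d)) = 2 * Γ * (n * r ^ d) := by rw [hΓ, mul_pow _ r]; ring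
      _ ≤ 2 * Γ * ((1 / (64 * Γ)) / r) := by gcongr; exact h1.trans (by gcongr)
      _ = 1 / (32 * r) := by field_simp; norm_num
  have h3 : L ≤ 1 / r := by
    rw [le_div_iff₀ hr, mul_comm]; exact hrL.trans hc1
  have h4 : 1 / (16 * r) - 1 / (32 * r) = 1 / 32 * (1 / r) := by field_simp; norm_num
  linarith [mul_le_mul_of_nonneg_left h3 (by norm_num : (0 : ℝ) ≤ 1 / 32)]

theorem tendsto_no_temporal_source {d : ℕ} (hd : 0 < d) {B c : ℝ} (hB : 0 < B) (hc1 : c ≤ 1)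
    (hc2 : c ≤ 1 / (64 * (B * (4 * d) ^ d))) {K : ℝ → ℝ} (hKm : Measurable K)
    (hK : ∀ t, 0 ≤ t → K t ≤ B * Real.exp (-t)) {r : ℕ → ℝ} (hr : ∀ n, 0 < r n)
    (hrc : ∀ᶠ n : ℕ in atTop, r n ≤ c * (n : ℝ) ^ (-(1 / ((d : ℝ) + 1)))) :
    Tendsto (fun n : ℕ => volume {ω : TRGGSample d n |
      ∀ u : Fin n, ¬ (temporalRGG K (r n) ω).IsTemporalSource u}) atTop (𝓝 1) := by
  have h1 : Tendsto (fun n : ℕ => (2⁻¹ : ℝ≥0∞) ^ (n - 1)) atTop (𝓝 0) :=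
    (ENNReal.tendsto_pow_atTop_nhds_zero_of_lt_one (by simp)).comp
      (tendsto_sub_atTop_nat 1)
  have h2 := h1.add (tendsto_hopScale_pow_mul_exp_neg d (d + 1) 2 (b := 1 / 32) (by norm_num))
  rw [add_zero] at h2
  refine tendsto_volume_one_of_compl h2 ?_
  filter_upwards [hrc, eventually_gt_atTop 0] with n hn hn0
  rw [rpow_neg_eq_inv_hopScale] at hn
  have hset : {ω : TRGGSample d n | ∀ u : Fin n, ¬ (temporalRGG K (r n) ω).IsTemporalSource u}ᶜ =
      {ω : TRGGSample d n | ∃ u, (temporalRGG K (r n) ω).IsTemporalSource u} := by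
    ext ω
    simp
  rw [hset]
  refine (volume_exists_source_le hd hn0 hKm hB (hr n) hK).trans
    (add_le_add le_rfl (ENNReal.ofReal_le_ofReal ?_))
  rw [hopScale_pow, ← mul_assoc, mul_comm (n : ℝ) 2]
  gcongr
  exact first_moment_exponent_le hn0 hB (hr n) hd hc1 hc2 hn

/-! ### Cells of the torus -/

/-- The centre of the cell `c` in the grid with `k` cells per side. -/
noncomputable def cellCenter {d k : ℕ} [NeZero k] (c : Fin d → ZMod k) : UnitAddTorus (Fin d) :=
  fun i => ZMod.toAddCircle (c i)

theorem exists_toAddCircle_near {k : ℕ} [NeZero k] (y : UnitAddCircle) :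
    ∃ c : ZMod k, ‖y - ZMod.toAddCircle c‖ ≤ 1 / (2 * k) := by
  have hk : (0 : ℝ) < k := Nat.cast_pos.2 (NeZero.pos k)
  induction y using QuotientAddGroup.induction_on with
  | H t =>
    refine ⟨(round (t * k) : ℤ), ?_⟩
    rw [ZMod.toAddCircle_intCast]
    calc ‖(t : UnitAddCircle) - ((round (t * k) / k : ℝ) : UnitAddCircle)‖
        = ‖((t - round (t * k) / k : ℝ) : UnitAddCircle)‖ := by rw [AddCircle.coe_sub]
      _ ≤ ‖(t - round (t * k) / k : ℝ)‖ := by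
        rw [UnitAddCircle.norm_eq, Real.norm_eq_abs]
        simpa using round_le (t - round (t * k) / k : ℝ) 0
      _ = |t * k - round (t * k)| / k := by
        rw [Real.norm_eq_abs, ← abs_of_pos hk, ← abs_div, abs_of_pos hk]
        congr 1
        field_simp
      _ ≤ 1 / 2 / k := by gcongr; exact abs_sub_round _
      _ = _ := by field_simp

theorem exists_cellCenter_near {d k : ℕ} [NeZero k] (y : UnitAddTorus (Fin d)) :
    ∃ c : Fin d → ZMod k, ‖y - cellCenter c‖ ≤ 1 / (2 * k) := by
  choose c hc using fun i => exists_toAddCircle_near (k := k) (y i)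
  exact ⟨c, (pi_norm_le_iff_of_nonneg (by positivity)).2 hc⟩

theorem norm_toAddCircle_one {k : ℕ} [NeZero k] (hk : 2 ≤ k) :
    ‖(ZMod.toAddCircle (1 : ZMod k) : UnitAddCircle)‖ = 1 / k := by
  have hk' : (2 : ℝ) ≤ k := by exact_mod_cast hk
  have h1 := ZMod.toAddCircle_natCast (N := k) 1
  rw [Nat.cast_one] at h1
  have h2 : |1 / (k : ℝ)| = 1 / k := abs_of_nonneg (by positivity)
  rw [h1, Nat.cast_one, (AddCircle.norm_coe_eq_abs_iff 1 one_ne_zero).2, h2]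
  rw [h2, abs_one]
  gcongr

theorem cellCenter_add_single_sub {d k : ℕ} [NeZero k] (c : Fin d → ZMod k) (i : Fin d) :
    cellCenter (c + Pi.single i 1) - cellCenter c = Pi.single i (ZMod.toAddCircle (1 : ZMod k)) := by
  funext j
  simp only [cellCenter, Pi.sub_apply, Pi.add_apply, map_add, add_sub_cancel_left]
  rcases eq_or_ne j i with rfl | h
  · simp
  · simp [h]

theorem norm_cellCenter_add_single_sub {d k : ℕ} [NeZero k] (hk : 2 ≤ k) (c : Fin d → ZMod k)
    (i : Fin d) : ‖cellCenter (c + Pi.single i 1) - cellCenter c‖ = 1 / k := by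
  rw [cellCenter_add_single_sub, Pi.norm_single, norm_toAddCircle_one hk]

theorem torusDist_le_mul_norm {d : ℕ} (x y : UnitAddTorus (Fin d)) :
    torusDist x y ≤ d * ‖x - y‖ := by
  refine Real.sqrt_le_iff.2 ⟨by positivity, ?_⟩
  calc ∑ i, ‖x i - y i‖ ^ 2 ≤ ∑ _i : Fin d, ‖x - y‖ ^ 2 := by
        gcongr with i
        exact norm_le_pi_norm (x - y) i
    _ = d * ‖x - y‖ ^ 2 := by simp
    _ ≤ d ^ 2 * ‖x - y‖ ^ 2 := by
        gcongr
        exact_mod_cast Nat.le_self_pow two_ne_zero d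
    _ = _ := by ring

theorem volume_cell {d k : ℕ} [NeZero k] (c : Fin d → ZMod k) :
    volume (Metric.closedBall (cellCenter c) (1 / (4 * k))) =
      ENNReal.ofReal ((1 / (2 * k)) ^ d) := by
  have hk : (1 : ℝ) ≤ k := by exact_mod_cast NeZero.one_le
  rw [closedBall_pi _ (by positivity), volume_pi_pi]
  simp only [AddCircle.volume_closedBall]
  have h : min (1 : ℝ) (2 * (1 / (4 * k))) = 1 / (2 * k) := by
    rw [show 2 * (1 / (4 * (k : ℝ))) = 1 / (2 * k) by field_simp; norm_num, min_eq_right]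
    rw [div_le_one (by positivity)]
    linarith
  rw [h, Finset.prod_const, Finset.card_univ, Fintype.card_fin, ENNReal.ofReal_pow (by positivity)]

/-- A property of cells that persists in time and spreads to the next cell in every coordinate
direction reaches every cell within `d * (k - 1)` time steps. -/
theorem cell_spread {d k N : ℕ} [NeZero k] (hN : d * (k - 1) ≤ N)
    {P : ℕ → (Fin d → ZMod k) → Prop} (hmono : ∀ j c, P j c → P (j + 1) c)
    (hstep : ∀ j < N, ∀ c i, P j c → P (j + 1) (c + Pi.single i 1))
    {c : Fin d → ZMod k} (h0 : P 0 c) (b : Fin d → ZMod k) : P (d * (k - 1)) b := by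
  have hmono' : ∀ j j' c, j ≤ j' → P j c → P j' c := fun j j' c hj h =>
    Nat.le_induction h (fun j' _ h' => hmono j' c h') j' hj
  have hmany : ∀ (a j : ℕ) (c : Fin d → ZMod k) (i : Fin d), j + a ≤ N → P j c →
      P (j + a) (c + a • Pi.single i 1) := by
    intro a j c i
    induction a with
    | zero => intro _ h; simpa using h
    | succ a ih =>
      intro hj h
      have := hstep (j + a) (by omega) _ i (ih (by omega) h)
      rw [succ_nsmul, ← add_assoc c]
      exact this
  have hset : ∀ F : Finset (Fin d),
      P (F.card * (k - 1)) (c + ∑ i ∈ F, ((b - c) i).val • Pi.single i 1) := by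
    intro F
    induction F using Finset.induction_on with
    | empty => simpa using h0
    | insert i F hi ih =>
      have hval : ((b - c) i).val ≤ k - 1 := Nat.le_sub_one_of_lt (ZMod.val_lt _)
      have hcard : (insert i F).card * (k - 1) ≤ d * (k - 1) := by
        gcongr
        exact (Finset.card_le_univ _).trans_eq (Fintype.card_fin d)
      rw [Finset.card_insert_of_notMem hi, add_mul, one_mul] at hcard ⊢
      have := hmany ((b - c) i).val _ _ i (by omega) ih
      rw [Finset.sum_insert hi, add_comm (_ • _), ← add_assoc]
      exact hmono' _ _ _ (by omega) this
  have hb : c + ∑ i : Fin d, ((b - c) i).val • Pi.single i (1 : ZMod k) = b := by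
    funext j
    rw [Pi.add_apply, Finset.sum_apply, Finset.sum_eq_single j]
    · simp
    · intro i _ hij
      simp [Pi.single_eq_of_ne hij.symm]
    · simp
  have := hset Finset.univ
  rwa [hb, Finset.card_univ, Fintype.card_fin] at this

/-! ### Spreading of temporal walks through the cells -/

/-- The `j`-th of the time points that divide `[1 / 4, 3 / 4]` into `N` windows. -/
noncomputable def windowTime (N j : ℕ) : ℝ := 1 / 4 + j / (2 * N)

theorem windowTime_succ_sub (N j : ℕ) :
    windowTime N (j + 1) - windowTime N j = 1 / (2 * N) := by
  unfold windowTime; push_cast; ring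

theorem windowTime_le_succ (N j : ℕ) : windowTime N j ≤ windowTime N (j + 1) := by
  have : (0 : ℝ) ≤ 1 / (2 * N) := by positivity
  linarith [windowTime_succ_sub N j]

theorem windowTime_le {N j : ℕ} (h : j ≤ N) : windowTime N j ≤ 3 / 4 := by
  have : (j : ℝ) / (2 * N) ≤ 1 / 2 := by
    rcases N.eq_zero_or_pos with rfl | hN
    · simp
    · have hN' : (0 : ℝ) < N := Nat.cast_pos.2 hN
      rw [div_le_iff₀ (by positivity)]
      have : (j : ℝ) ≤ N := by exact_mod_cast h
      linarith
  unfold windowTime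
  linarith

/-- If every vertex has `s` early neighbours and `s` late neighbours in some cell, and in every
window of time any `s` vertices of a cell are joined to any `s` vertices of each next cell, then the
graph is temporally connected. -/
theorem temporallyConnected_of_expansion {V : Type*} [DecidableEq V] {d k s : ℕ} [NeZero d]
    [NeZero k] (T : TemporalGraph V) {A : (Fin d → ZMod k) → Finset V}
    (hA : ∀ c, 2 * s ≤ (A c).card)
    (hout : ∀ u, ∃ c, ∃ S ⊆ A c, s ≤ S.card ∧
      ∀ w ∈ S, T.graph.Adj u w ∧ T.stamp s(u, w) ≤ 1 / 4)
    (hin : ∀ v, ∃ c, ∃ S ⊆ A c, s ≤ S.card ∧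
      ∀ w ∈ S, T.graph.Adj w v ∧ 3 / 4 ≤ T.stamp s(w, v))
    (hexp : ∀ c i, ∀ j < d * k, ∀ S ⊆ A c, ∀ B ⊆ A (c + Pi.single i 1), S.card = s → B.card = s →
      ∃ v ∈ S, ∃ w ∈ B, T.graph.Adj v w ∧ windowTime (d * k) j ≤ T.stamp s(v, w) ∧
        T.stamp s(v, w) ≤ windowTime (d * k) (j + 1)) :
    T.TemporallyConnected := by
  classical
  intro u v
  set N := d * k with hN
  let P : ℕ → (Fin d → ZMod k) → Prop := fun j c =>
    ∃ S ⊆ A c, S.card = s ∧ ∀ w ∈ S, T.ReachesBy u w (windowTime N j)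
  have hmono : ∀ j c, P j c → P (j + 1) c := by
    rintro j c ⟨S, hS, hs, h⟩
    exact ⟨S, hS, hs, fun w hw => (h w hw).mono (windowTime_le_succ N j)⟩
  have hstep : ∀ j < N, ∀ c i, P j c → P (j + 1) (c + Pi.single i 1) := by
    rintro j hj c i ⟨S, hS, hs, h⟩
    -- fewer than `s` vertices of the next cell are missed, which leaves more than `s` of them
    set R := (A (c + Pi.single i 1)).filter fun w => T.ReachesBy u w (windowTime N (j + 1)) with hR
    have hR' : s ≤ R.card := by
      by_contra! hlt
      have hcard := Finset.card_sdiff_add_card_eq_card (Finset.filter_subset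
        (fun w => T.ReachesBy u w (windowTime N (j + 1))) (A (c + Pi.single i 1)))
      rw [← hR] at hcard
      have := hA (c + Pi.single i 1)
      obtain ⟨B, hB, hBs⟩ := Finset.exists_subset_card_eq
        (show s ≤ (A (c + Pi.single i 1) \ R).card by omega)
      obtain ⟨v, hv, w, hw, hadj, h1, h2⟩ :=
        hexp c i j hj S hS B (hB.trans Finset.sdiff_subset) hs hBs
      have hw' := Finset.mem_sdiff.1 (hB hw)
      exact hw'.2 (Finset.mem_filter.2 ⟨hw'.1, (h v hv).step hadj h1 h2⟩)
    obtain ⟨R', hR'', hcard⟩ := Finset.exists_subset_card_eq hR'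
    exact ⟨R', hR''.trans (Finset.filter_subset _ _), hcard,
      fun w hw => (Finset.mem_filter.1 (hR'' hw)).2⟩
  obtain ⟨c, S, hS, hs, hSu⟩ := hout u
  obtain ⟨S', hS', hs'⟩ := Finset.exists_subset_card_eq hs
  have h0 : P 0 c := by
    refine ⟨S', hS'.trans hS, hs', fun w hw => ?_⟩
    obtain ⟨h1, h2⟩ := hSu w (hS' hw)
    exact (T.reachesBy_refl u _).step h1 le_rfl (h2.trans (by simp [windowTime]))
  obtain ⟨b, B, hB, hBs, hBv⟩ := hin v
  obtain ⟨B', hB', hBs'⟩ := Finset.exists_subset_card_eq hBs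
  have hlt : d * (k - 1) < N := by
    have hd := NeZero.pos d
    have hk := NeZero.pos k
    exact Nat.mul_lt_mul_of_pos_left (by omega) hd
  -- the last window is kept for the step into the late neighbours of `v`
  obtain ⟨R, hR, hRs, hRu⟩ := cell_spread hlt.le hmono hstep h0 (b - Pi.single 0 1)
  obtain ⟨x, hx, w, hw, hadj, h1, h2⟩ := hexp (b - Pi.single 0 1) 0 _ hlt R hR B'
    (by rw [sub_add_cancel]; exact hB'.trans hB) hRs hBs'
  obtain ⟨h3, h4⟩ := hBv w (hB' hw)
  exact (((hRu x hx).step hadj h1 h2).step h3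
    ((windowTime_le (Nat.succ_le_of_lt hlt)).trans h4) le_rfl).hasTemporalPath

/-! ### Above the threshold -/

theorem ofReal_le_unitInterval_volume_lt {c : ℝ} (hc : c ≤ 1) :
    ENNReal.ofReal c ≤ volume {y : unitInterval | (y : ℝ) < c} := by
  rw [unitInterval.volume_apply]
  calc ENNReal.ofReal c = volume (Set.Ico 0 c) := by rw [Real.volume_Ico, sub_zero]
    _ ≤ _ := by
      refine measure_mono fun y hy => ?_
      exact ⟨⟨y, hy.1, hy.2.le.trans hc⟩, hy.2, rfl⟩

theorem ofReal_le_unitInterval_volume_Icc {lo hi : ℝ} (hlo : 0 ≤ lo) (hhi : hi ≤ 1) :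
    ENNReal.ofReal (hi - lo) ≤ volume {y : unitInterval | lo ≤ (y : ℝ) ∧ (y : ℝ) ≤ hi} := by
  rw [unitInterval.volume_apply, ← Real.volume_Icc]
  exact measure_mono fun y hy => ⟨⟨y, hlo.trans hy.1, hy.2.trans hhi⟩, hy, rfl⟩

open scoped Classical in
/-- Pairs are open when their mark is below `a` and their time-stamp lies in `[lo, hi]`; this bounds
the probability that fewer than `s` of the pairs in `F` are open. -/
theorem volume_few_open_le {ι : Type*} [Fintype ι] (F : Finset ι) {a lo hi : ℝ} (ha0 : 0 ≤ a)
    (ha : a ≤ 1) (hlo : 0 ≤ lo) (hhi : hi ≤ 1) (s : ℕ) :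
    volume {y : (ι → unitInterval) × (ι → unitInterval) |
        (F.filter fun e => (y.1 e : ℝ) < a ∧ lo ≤ y.2 e ∧ y.2 e ≤ hi).card < s} ≤
      ENNReal.ofReal (2 ^ s * Real.exp (-(a * (hi - lo) / 2 * F.card))) := by
  let Q : Set (unitInterval × unitInterval) :=
    {m : unitInterval | (m : ℝ) < a} ×ˢ {t : unitInterval | lo ≤ (t : ℝ) ∧ (t : ℝ) ≤ hi}
  have h1 : MeasurableSet {m : unitInterval | (m : ℝ) < a} :=
    measurableSet_lt (by fun_prop) measurable_const
  have h2 : MeasurableSet {t : unitInterval | lo ≤ (t : ℝ)} :=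
    measurableSet_le measurable_const (by fun_prop)
  have h3 : MeasurableSet {t : unitInterval | (t : ℝ) ≤ hi} :=
    measurableSet_le (by fun_prop) measurable_const
  have hQm : MeasurableSet Q := h1.prod (h2.inter h3)
  have hQ : ENNReal.ofReal (a * (hi - lo)) ≤ volume Q := by
    rw [Measure.volume_eq_prod, Measure.prod_prod, ENNReal.ofReal_mul ha0]
    exact mul_le_mul' (ofReal_le_unitInterval_volume_lt ha)
      (ofReal_le_unitInterval_volume_Icc hlo hhi)
  rw [← (volume_measurePreserving_arrowProdEquivProdArrow unitInterval unitInterval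
    ι).measure_preimage_equiv]
  refine Eq.trans_le (congrArg _ ?_) (pi_card_lt_le volume F (fun _ => hQm) (fun _ _ => hQ) s)
  ext y
  simp only [Set.mem_preimage, Set.mem_ofPred_eq]
  refine iff_of_eq (congrArg (fun G : Finset ι => G.card < s) ?_)
  ext e
  simp only [Finset.mem_filter]
  exact Iff.rfl

theorem measure_biUnion_finset_le_card_mul {Ω ι : Type*} [MeasurableSpace Ω] (μ : Measure Ω)
    (F : Finset ι) {S : ι → Set Ω} {ε : ℝ≥0∞} (h : ∀ i ∈ F, μ (S i) ≤ ε) :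
    μ (⋃ i ∈ F, S i) ≤ F.card * ε :=
  (measure_biUnion_finset_le F S).trans
    ((Finset.sum_le_card_nsmul F _ ε h).trans_eq (nsmul_eq_mul _ _))

theorem card_image_sym2_star {V : Type*} [DecidableEq V] (u : V) (S : Finset V) :
    (S.image fun w => s(u, w)).card = S.card :=
  Finset.card_image_of_injective _ fun _ _ h => Sym2.congr_right.1 h

theorem card_image_sym2_product {V : Type*} [DecidableEq V] {S B : Finset V} (h : Disjoint S B) :
    ((S ×ˢ B).image fun p => s(p.1, p.2)).card = S.card * B.card := by
  rw [Finset.card_image_of_injOn, Finset.card_product]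
  rintro ⟨v, w⟩ hp ⟨v', w'⟩ hp' heq
  simp only [Finset.coe_product, Set.mem_prod, Finset.mem_coe] at hp hp'
  rcases Sym2.eq_iff.1 heq with ⟨rfl, rfl⟩ | ⟨rfl, rfl⟩
  · rfl
  · exact absurd hp'.2 (Finset.disjoint_left.1 h hp.1)

open scoped Classical in
/-- Given positions for which every cell holds a set of `m` vertices, the graph fails to be
temporally connected with small probability: a union bound over the conditions of
`temporallyConnected_of_expansion`. -/
theorem volume_slice_not_connected_le {d n k m s : ℕ} [NeZero d] [NeZero k] (hk : 2 ≤ k)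
    {K : ℝ → ℝ} {a r : ℝ} (ha0 : 0 ≤ a) (ha : a ≤ 1) (hKa : ∀ t, 0 ≤ t → t ≤ 1 → a ≤ K t)
    (hr : 2 * d / k ≤ r) (hms : 2 * s ≤ m) (x : Fin n → UnitAddTorus (Fin d))
    {A : (Fin d → ZMod k) → Finset (Fin n)} (hA : ∀ c, (A c).card = m)
    (hAx : ∀ c, ∀ v ∈ A c, x v ∈ Metric.closedBall (cellCenter c) (1 / (4 * k))) :
    volume {y : (Sym2 (Fin n) → unitInterval) × (Sym2 (Fin n) → unitInterval) |
        ¬ (temporalRGG K r (x, y)).TemporallyConnected} ≤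
      ENNReal.ofReal (n * (2 * (2 ^ s * Real.exp (-(a / 8 * (m - 1 : ℝ))))) +
        k ^ d * (d * (d * k * (2 ^ m * (2 ^ m *
          (2 * Real.exp (-(a / (4 * (d * k)) * s ^ 2)))))))) := by
  have hk0 : (0 : ℝ) < k := Nat.cast_pos.2 (NeZero.pos k)
  have hd0 : (0 : ℝ) < d := Nat.cast_pos.2 (NeZero.pos d)
  have hr0 : 0 < r := lt_of_lt_of_le (by positivity) hr
  set N := d * k with hN
  have hadj : ∀ (y : (Sym2 (Fin n) → unitInterval) × (Sym2 (Fin n) → unitInterval)) (v w : Fin n),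
      v ≠ w → ‖x v - x w‖ ≤ 2 / k → (y.1 s(v, w) : ℝ) < a →
      (temporalRGG K r (x, y)).graph.Adj v w := by
    intro y v w hne hdist hy
    refine ⟨hne, lt_of_lt_of_le hy (hKa _ (div_nonneg (Real.sqrt_nonneg _) hr0.le) ?_)⟩
    rw [div_le_one hr0]
    calc torusDist (x v) (x w) ≤ d * ‖x v - x w‖ := torusDist_le_mul_norm _ _
      _ ≤ d * (2 / k) := by gcongr
      _ = 2 * d / k := by ring
      _ ≤ r := hr
  choose cell hcell using fun u => exists_cellCenter_near (k := k) (x u)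
  have hnear_own : ∀ u, ∀ w ∈ A (cell u), ‖x u - x w‖ ≤ 2 / k := by
    intro u w hw
    have h1 := hAx _ w hw
    rw [Metric.mem_closedBall, dist_eq_norm] at h1
    calc ‖x u - x w‖ = ‖(x u - cellCenter (cell u)) - (x w - cellCenter (cell u))‖ := by
          congr 1; abel
      _ ≤ 1 / (2 * k) + 1 / (4 * k) := (norm_sub_le _ _).trans (add_le_add (hcell u) h1)
      _ ≤ 2 / k := by
          rw [← sub_nonneg, show 2 / (k : ℝ) - (1 / (2 * k) + 1 / (4 * k)) = 5 / (4 * k) by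
            field_simp; norm_num]
          positivity
  have hnear_next : ∀ c i, ∀ v ∈ A c, ∀ w ∈ A (c + Pi.single i 1), ‖x v - x w‖ ≤ 2 / k := by
    intro c i v hv w hw
    have h1 := hAx _ v hv
    have h2 := hAx _ w hw
    rw [Metric.mem_closedBall, dist_eq_norm] at h1 h2
    have h3 := norm_cellCenter_add_single_sub hk c i
    calc ‖x v - x w‖ = ‖((x v - cellCenter c) - (x w - cellCenter (c + Pi.single i 1))) -
          (cellCenter (c + Pi.single i 1) - cellCenter c)‖ := by congr 1; abel
      _ ≤ (1 / (4 * k) + 1 / (4 * k)) + 1 / k :=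
          (norm_sub_le _ _).trans (add_le_add ((norm_sub_le _ _).trans (add_le_add h1 h2)) h3.le)
      _ ≤ 2 / k := by
          rw [← sub_nonneg, show 2 / (k : ℝ) - (1 / (4 * k) + 1 / (4 * k) + 1 / k) =
            1 / (2 * k) by field_simp; norm_num]
          positivity
  have hdisj : ∀ c i, Disjoint (A c) (A (c + Pi.single i 1)) := by
    intro c i
    refine Finset.disjoint_left.2 fun v hv hw => ?_
    have h1 := hAx _ v hv
    have h2 := hAx _ v hw
    rw [Metric.mem_closedBall, dist_eq_norm] at h1 h2
    have h3 := norm_cellCenter_add_single_sub hk c i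
    have h4 : 1 / (k : ℝ) ≤ 1 / (4 * k) + 1 / (4 * k) := by
      calc 1 / (k : ℝ) = ‖(x v - cellCenter c) - (x v - cellCenter (c + Pi.single i 1))‖ := by
            rw [← h3]; congr 1; abel
        _ ≤ _ := (norm_sub_le _ _).trans (add_le_add h1 h2)
    have h5 : 1 / (k : ℝ) - (1 / (4 * k) + 1 / (4 * k)) = 1 / (2 * k) := by
      field_simp; norm_num
    have h6 : 0 < 1 / (2 * (k : ℝ)) := by positivity
    linarith
  let few : Finset (Sym2 (Fin n)) → ℝ → ℝ → ℕ →
      Set ((Sym2 (Fin n) → unitInterval) × (Sym2 (Fin n) → unitInterval)) := fun F lo hi s =>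
    {y | (F.filter fun e => (y.1 e : ℝ) < a ∧ lo ≤ y.2 e ∧ y.2 e ≤ hi).card < s}
  let star : Fin n → Finset (Sym2 (Fin n)) := fun u => ((A (cell u)).erase u).image fun w => s(u, w)
  let bad1 := ⋃ u ∈ (Finset.univ : Finset (Fin n)),
    few (star u) 0 (1 / 4) s ∪ few (star u) (3 / 4) 1 s
  let bad2 := ⋃ c ∈ (Finset.univ : Finset (Fin d → ZMod k)), ⋃ i ∈ (Finset.univ : Finset (Fin d)),
    ⋃ j ∈ Finset.range N, ⋃ S ∈ (A c).powersetCard s,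
    ⋃ B ∈ (A (c + Pi.single i 1)).powersetCard s,
      few ((S ×ˢ B).image fun p => s(p.1, p.2)) (windowTime N j) (windowTime N (j + 1)) 1
  have hsub : {y : (Sym2 (Fin n) → unitInterval) × (Sym2 (Fin n) → unitInterval) |
      ¬ (temporalRGG K r (x, y)).TemporallyConnected} ⊆ bad1 ∪ bad2 := by
    intro y hy
    by_contra hbad
    refine hy ?_
    have hb1 : ∀ u, y ∉ few (star u) 0 (1 / 4) s ∧ y ∉ few (star u) (3 / 4) 1 s := by
      intro u
      have h : y ∉ few (star u) 0 (1 / 4) s ∪ few (star u) (3 / 4) 1 s := fun h =>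
        hbad (Or.inl (Set.mem_iUnion₂.2 ⟨u, Finset.mem_univ u, h⟩))
      exact ⟨fun h' => h (Or.inl h'), fun h' => h (Or.inr h')⟩
    have hstar : ∀ u lo hi, y ∉ few (star u) lo hi s → ∃ S ⊆ A (cell u), s ≤ S.card ∧
        ∀ w ∈ S, (temporalRGG K r (x, y)).graph.Adj u w ∧
          lo ≤ (temporalRGG K r (x, y)).stamp s(u, w) ∧
          (temporalRGG K r (x, y)).stamp s(u, w) ≤ hi := by
      intro u lo hi h
      refine ⟨((A (cell u)).erase u).filter fun w => (y.1 s(u, w) : ℝ) < a ∧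
        lo ≤ y.2 s(u, w) ∧ y.2 s(u, w) ≤ hi,
        (Finset.filter_subset _ _).trans (Finset.erase_subset _ _), ?_, ?_⟩
      · have h' : s ≤ ((star u).filter fun e =>
          (y.1 e : ℝ) < a ∧ lo ≤ y.2 e ∧ y.2 e ≤ hi).card := not_lt.1 h
        rw [Finset.filter_image] at h'
        exact h'.trans Finset.card_image_le
      · intro w hw
        obtain ⟨hw, h1, h2, h3⟩ := Finset.mem_filter.1 hw
        obtain ⟨hne, hw⟩ := Finset.mem_erase.1 hw
        exact ⟨hadj y u w hne.symm (hnear_own u w hw) h1, h2, h3⟩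
    refine temporallyConnected_of_expansion (s := s) _ (A := A) (fun c => (hA c).symm ▸ hms)
      ?_ ?_ ?_
    · intro u
      obtain ⟨S, h1, h2, h3⟩ := hstar u _ _ (hb1 u).1
      exact ⟨cell u, S, h1, h2, fun w hw => ⟨(h3 w hw).1, (h3 w hw).2.2⟩⟩
    · intro u
      obtain ⟨S, h1, h2, h3⟩ := hstar u _ _ (hb1 u).2
      refine ⟨cell u, S, h1, h2, fun w hw => ⟨(h3 w hw).1.symm, ?_⟩⟩
      rw [Sym2.eq_swap]
      exact (h3 w hw).2.1
    · intro c i j hj S hS B hB hSs hBs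
      have h : y ∉ few ((S ×ˢ B).image fun p => s(p.1, p.2)) (windowTime N j)
          (windowTime N (j + 1)) 1 := by
        intro h
        refine hbad (Or.inr ?_)
        simp only [bad2, Set.mem_iUnion]
        exact ⟨c, Finset.mem_univ _, i, Finset.mem_univ _, j, Finset.mem_range.2 hj, S,
          Finset.mem_powersetCard.2 ⟨hS, hSs⟩, B, Finset.mem_powersetCard.2 ⟨hB, hBs⟩, h⟩
      have h' := Finset.card_pos.1 (Nat.one_le_iff_ne_zero.1 (not_lt.1 h) |> Nat.pos_of_ne_zero)
      obtain ⟨e, he⟩ := h'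
      obtain ⟨he, h1, h2, h3⟩ := Finset.mem_filter.1 he
      obtain ⟨⟨v, w⟩, hp, rfl⟩ := Finset.mem_image.1 he
      obtain ⟨hv, hw⟩ := Finset.mem_product.1 hp
      refine ⟨v, hv, w, hw, hadj y v w ?_ (hnear_next c i v (hS hv) w (hB hw)) h1, h2, h3⟩
      exact fun hvw => Finset.disjoint_left.1 (hdisj c i) (hS hv) (by rw [hvw]; exact hB hw)
  have hstar_card : ∀ u, (m - 1 : ℝ) ≤ (star u).card := by
    intro u
    rw [card_image_sym2_star]
    have := Finset.pred_card_le_card_erase (s := A (cell u)) (a := u)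
    rw [hA] at this
    have h' : m ≤ ((A (cell u)).erase u).card + 1 := by omega
    have h'' : (m : ℝ) ≤ ((A (cell u)).erase u).card + 1 := by exact_mod_cast h'
    linarith
  have hbad1 : volume bad1 ≤
      ENNReal.ofReal (n * (2 * (2 ^ s * Real.exp (-(a / 8 * (m - 1 : ℝ)))))) := by
    have hone : ∀ u lo hi, 0 ≤ lo → hi ≤ 1 → hi - lo = 1 / 4 → volume (few (star u) lo hi s) ≤
        ENNReal.ofReal (2 ^ s * Real.exp (-(a / 8 * (m - 1 : ℝ)))) := by
      intro u lo hi h1 h2 h3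
      refine (volume_few_open_le (star u) ha0 ha h1 h2 s).trans (ENNReal.ofReal_le_ofReal ?_)
      rw [h3, show a * (1 / 4) / 2 = a / 8 by ring]
      gcongr
      exact hstar_card u
    refine (measure_biUnion_finset_le_card_mul volume Finset.univ
      (ε := ENNReal.ofReal (2 * (2 ^ s * Real.exp (-(a / 8 * (m - 1 : ℝ)))))) fun u _ => ?_).trans ?_
    · rw [two_mul, ENNReal.ofReal_add (by positivity) (by positivity)]
      exact (measure_union_le _ _).trans (add_le_add
        (hone u _ _ le_rfl (by norm_num) (by norm_num))
        (hone u _ _ (by norm_num) le_rfl (by norm_num)))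
    · rw [Finset.card_univ, Fintype.card_fin, ENNReal.ofReal_mul (Nat.cast_nonneg n),
        ENNReal.ofReal_natCast]
  have hbad2 : volume bad2 ≤ ENNReal.ofReal (k ^ d * (d * (d * k * (2 ^ m * (2 ^ m *
      (2 * Real.exp (-(a / (4 * (d * k)) * s ^ 2)))))))) := by
    set ε := ENNReal.ofReal (2 * Real.exp (-(a / (4 * (d * k)) * s ^ 2))) with hε
    have hpow : ∀ c, (((A c).powersetCard s).card : ℝ≥0∞) ≤ 2 ^ m := by
      intro c
      rw [Finset.card_powersetCard, hA]
      exact_mod_cast Nat.choose_le_two_pow m s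
    have h1 : volume bad2 ≤ (Finset.univ : Finset (Fin d → ZMod k)).card *
        ((Finset.univ : Finset (Fin d)).card * ((Finset.range N).card *
          (2 ^ m * (2 ^ m * ε)))) := by
      refine measure_biUnion_finset_le_card_mul _ _ fun c _ => ?_
      refine measure_biUnion_finset_le_card_mul _ _ fun i _ => ?_
      refine measure_biUnion_finset_le_card_mul _ _ fun j hj => ?_
      refine (measure_biUnion_finset_le_card_mul _ _ (ε := 2 ^ m * ε) fun S hS => ?_).trans
        (mul_le_mul_left (hpow c) _)
      refine (measure_biUnion_finset_le_card_mul _ _ (ε := ε) fun B hB => ?_).trans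
        (mul_le_mul_left (hpow _) _)
      obtain ⟨hS, hSs⟩ := Finset.mem_powersetCard.1 hS
      obtain ⟨hB, hBs⟩ := Finset.mem_powersetCard.1 hB
      have hj' : windowTime N (j + 1) ≤ 1 :=
        (windowTime_le (Nat.succ_le_of_lt (Finset.mem_range.1 hj))).trans (by norm_num)
      have hj0 : 0 ≤ windowTime N j := by unfold windowTime; positivity
      refine (volume_few_open_le _ ha0 ha hj0 hj' 1).trans (le_of_eq ?_)
      rw [windowTime_succ_sub, card_image_sym2_product (((hdisj c i).mono_left hS).mono_right hB),
        hSs, hBs, hε, hN]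
      congr 3
      · norm_num
      · push_cast; field_simp; ring
    refine h1.trans (le_of_eq ?_)
    rw [Finset.card_univ, Finset.card_univ, Finset.card_range, Fintype.card_fin, Fintype.card_fun,
      ZMod.card, Fintype.card_fin, hN, hε, ENNReal.ofReal_mul (by positivity),
      ENNReal.ofReal_mul (by positivity),
      ENNReal.ofReal_mul (by positivity), ENNReal.ofReal_mul (by positivity),
      ENNReal.ofReal_mul (by positivity), ENNReal.ofReal_mul (by positivity),
      ENNReal.ofReal_mul (by positivity), ENNReal.ofReal_pow (by positivity),
      ENNReal.ofReal_pow (by positivity), ENNReal.ofReal_natCast, ENNReal.ofReal_natCast]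
    push_cast
    simp
  rw [ENNReal.ofReal_add (by positivity) (by positivity)]
  exact (measure_mono hsub).trans ((measure_union_le _ _).trans (add_le_add hbad1 hbad2))

open scoped Classical in
theorem volume_sparse_cell_le {d n k m : ℕ} [NeZero k] :
    volume {x : Fin n → UnitAddTorus (Fin d) | ∃ c : Fin d → ZMod k,
        (Finset.univ.filter fun v =>
          x v ∈ Metric.closedBall (cellCenter c) (1 / (4 * k))).card < m} ≤
      ENNReal.ofReal (k ^ d * (2 ^ m * Real.exp (-((1 / (2 * k)) ^ d / 2 * n)))) := by
  have hset : {x : Fin n → UnitAddTorus (Fin d) | ∃ c : Fin d → ZMod k,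
        (Finset.univ.filter fun v =>
          x v ∈ Metric.closedBall (cellCenter c) (1 / (4 * k))).card < m} =
      ⋃ c ∈ (Finset.univ : Finset (Fin d → ZMod k)), {x : Fin n → UnitAddTorus (Fin d) |
        (Finset.univ.filter fun v =>
          x v ∈ Metric.closedBall (cellCenter c) (1 / (4 * k))).card < m} := by
    ext x
    simp
  rw [hset]
  refine (measure_biUnion_finset_le_card_mul _ _ fun c _ =>
    pi_card_lt_le (volume : Measure (UnitAddTorus (Fin d))) Finset.univ
      (fun _ => Metric.isClosed_closedBall.measurableSet)
      (fun _ _ => (volume_cell c).ge) m).trans (le_of_eq ?_)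
  rw [Finset.card_univ, Finset.card_univ, Fintype.card_fun, ZMod.card, Fintype.card_fin,
    Fintype.card_fin, ENNReal.ofReal_mul (by positivity), ENNReal.ofReal_mul (by positivity),
    ENNReal.ofReal_mul (by positivity), ENNReal.ofReal_pow (by positivity),
    ENNReal.ofReal_pow (by positivity), ENNReal.ofReal_natCast]
  push_cast
  rfl

/-- Integrating the bound for fixed positions over the positions. The set of positions with a sparse
cell enters through its measurable hull, so its measurability is not an issue. -/
theorem volume_not_connected_le {d n k m s : ℕ} [NeZero d] [NeZero k] (hk : 2 ≤ k)
    {K : ℝ → ℝ} (hKm : Measurable K) {a r : ℝ} (ha0 : 0 ≤ a) (ha : a ≤ 1)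
    (hKa : ∀ t, 0 ≤ t → t ≤ 1 → a ≤ K t) (hr : 2 * d / k ≤ r) (hms : 2 * s ≤ m) :
    volume {ω : TRGGSample d n | ¬ (temporalRGG K r ω).TemporallyConnected} ≤
      ENNReal.ofReal (k ^ d * (2 ^ m * Real.exp (-((1 / (2 * k)) ^ d / 2 * n))) +
        (n * (2 * (2 ^ s * Real.exp (-(a / 8 * (m - 1 : ℝ))))) +
        k ^ d * (d * (d * k * (2 ^ m * (2 ^ m *
          (2 * Real.exp (-(a / (4 * (d * k)) * s ^ 2))))))))) := by
  classical
  set ε : ℝ := n * (2 * (2 ^ s * Real.exp (-(a / 8 * (m - 1 : ℝ))))) +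
    k ^ d * (d * (d * k * (2 ^ m * (2 ^ m *
      (2 * Real.exp (-(a / (4 * (d * k)) * s ^ 2))))))) with hε
  have hε0 : 0 ≤ ε := by positivity
  set bad : Set (Fin n → UnitAddTorus (Fin d)) := {x | ∃ c : Fin d → ZMod k,
    (Finset.univ.filter fun v =>
      x v ∈ Metric.closedBall (cellCenter c) (1 / (4 * k))).card < m} with hbad
  have hmeas : MeasurableSet {ω : TRGGSample d n | ¬ (temporalRGG K r ω).TemporallyConnected} :=
    (measurableSet_temporallyConnected hKm r).compl
  rw [Measure.volume_eq_prod, Measure.prod_apply hmeas]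
  calc _ ≤ ∫⁻ x : Fin n → UnitAddTorus (Fin d),
        ((toMeasurable volume bad).indicator 1 x + ENNReal.ofReal ε) := by
        refine lintegral_mono fun x => ?_
        by_cases hx : x ∈ bad
        · rw [Set.indicator_of_mem (subset_toMeasurable volume bad hx)]
          exact prob_le_one.trans le_self_add
        · have hx' : ∀ c : Fin d → ZMod k, m ≤ (Finset.univ.filter fun v =>
              x v ∈ Metric.closedBall (cellCenter c) (1 / (4 * k))).card := fun c =>
            not_lt.1 fun h => hx ⟨c, h⟩
          choose A hA hAm using fun c => Finset.exists_subset_card_eq (hx' c)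
          refine le_trans ?_ (le_add_left le_rfl)
          exact volume_slice_not_connected_le hk ha0 ha hKa hr hms x hAm
            fun c v hv => (Finset.mem_filter.1 (hA c hv)).2
    _ = volume bad + ENNReal.ofReal ε := by
        rw [lintegral_add_right _ measurable_const,
          lintegral_indicator_one (measurableSet_toMeasurable _ _), measure_toMeasurable]
        simp
    _ ≤ _ := by
        rw [ENNReal.ofReal_add (by positivity) hε0]
        gcongr
        exact volume_sparse_cell_le

/-- The numerical part of the union bound. With `s = ⌈L⌉`, `m = M * s` and about `2 * d * L / C`
cells per side, a large constant `C` makes every exponential at most `exp (-L)`. -/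
theorem union_bound_le {d n M s k : ℕ} {a C L : ℝ} (hd : 1 ≤ d) (ha0 : 0 < a) (ha : a ≤ 1)
    (hL : 1 ≤ L) (hLn : L ^ (d + 1) = n) (hM : 16 / a + 1 ≤ M) (hC : 48 * d ^ 2 * M / a ≤ C)
    (hs1 : L ≤ s) (hs2 : s ≤ 2 * L) (hk0 : 0 < k) (hk : k ≤ 3 * d * L / C) :
    k ^ d * (2 ^ (M * s) * Real.exp (-((1 / (2 * k)) ^ d / 2 * n))) +
      (n * (2 * (2 ^ s * Real.exp (-(a / 8 * ((M * s : ℕ) - 1 : ℝ))))) +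
      k ^ d * (d * (d * k * (2 ^ (M * s) * (2 ^ (M * s) *
        (2 * Real.exp (-(a / (4 * (d * k)) * s ^ 2)))))))) ≤
      (3 + 2 * d ^ 2) * L ^ (d + 1) * Real.exp (-(1 * L)) := by
  have hd' : (1 : ℝ) ≤ d := by exact_mod_cast hd
  have hk0' : (0 : ℝ) < k := Nat.cast_pos.2 hk0
  have hM1 : (1 : ℝ) ≤ M := by
    have : 0 < 16 / a := by positivity
    linarith
  have hs0 : (1 : ℝ) ≤ s := hL.trans hs1
  have hCa : 48 * d ^ 2 * M ≤ C * a := (div_le_iff₀ ha0).1 hC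
  have hdd : (d : ℝ) ≤ d ^ 2 := by nlinarith
  have hCd : 48 * d * M ≤ C := by
    have h1 : C * a ≤ C := by
      have : 0 ≤ C := le_trans (by positivity) hC
      nlinarith
    have h2 : (48 * d * M : ℝ) ≤ 48 * d ^ 2 * M := by gcongr
    linarith
  have hC48 : 48 * d ≤ C := by nlinarith
  have hC0 : 0 < C := by linarith
  have hkL : (k : ℝ) ≤ L := by
    refine hk.trans ((div_le_iff₀ hC0).2 ?_)
    nlinarith
  have h2e : ∀ j : ℕ, (2 : ℝ) ^ j ≤ Real.exp j := by
    intro j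
    calc (2 : ℝ) ^ j ≤ Real.exp 1 ^ j := by
          gcongr
          linarith [Real.add_one_le_exp 1]
      _ = Real.exp j := by rw [← Real.exp_nat_mul, mul_one]
  have hms : L ≤ (M * s : ℕ) := by push_cast; nlinarith
  have hpos : 2 ^ (M * s) * Real.exp (-((1 / (2 * k)) ^ d / 2 * n)) ≤ Real.exp (-(1 * L)) := by
    have h1 : L * (C / (6 * d)) ≤ (1 / (2 * k)) ^ d * n := by
      have h2 : C / (6 * d) / L ≤ 1 / (2 * k) := by
        rw [div_div, div_le_div_iff₀ (by positivity) (by positivity)]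
        have := (le_div_iff₀ hC0).1 hk
        nlinarith
      have h3 : 1 ≤ C / (6 * d) := by rw [le_div_iff₀ (by positivity)]; linarith
      calc L * (C / (6 * d)) ≤ L * (C / (6 * d)) ^ d := by
            gcongr
            exact le_self_pow₀ h3 (by omega)
        _ = (C / (6 * d) / L) ^ d * n := by
            rw [← hLn, div_pow _ L, pow_succ]; field_simp
        _ ≤ _ := by gcongr
    have h4 : 8 * (M * L) ≤ L * (C / (6 * d)) := by
      rw [mul_comm (M : ℝ) L, ← mul_assoc, mul_comm 8 L, mul_assoc]
      gcongr
      rw [le_div_iff₀ (by positivity)]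
      linarith
    have h5 : (M * s : ℝ) ≤ 2 * (M * L) := by nlinarith
    refine (mul_le_mul_of_nonneg_right (h2e _) (Real.exp_pos _).le).trans ?_
    rw [← Real.exp_add]
    gcongr
    push_cast at hms ⊢
    linarith
  have hout : 2 ^ s * Real.exp (-(a / 8 * ((M * s : ℕ) - 1 : ℝ))) ≤ Real.exp (-(1 * L)) := by
    refine (mul_le_mul_of_nonneg_right (h2e _) (Real.exp_pos _).le).trans ?_
    rw [← Real.exp_add]
    gcongr
    push_cast
    have h1 : 16 / a * s ≤ (M - 1) * s := by gcongr; linarith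
    have h2 : a / 8 * (16 / a * s) ≤ a / 8 * (M * s - 1) := by gcongr; linarith
    have h3 : a / 8 * (16 / a * s) = 2 * s := by field_simp; norm_num
    linarith
  have hexp : 2 ^ (M * s) * (2 ^ (M * s) * (2 * Real.exp (-(a / (4 * (d * k)) * s ^ 2)))) ≤
      2 * Real.exp (-(1 * L)) := by
    have h1 : 3 * (M * s) ≤ a / (4 * (d * k)) * s ^ 2 := by
      have h2 : k * C ≤ 3 * d * s := by
        have := (le_div_iff₀ hC0).1 hk
        nlinarith
      rw [div_mul_eq_mul_div, le_div_iff₀ (by positivity)]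
      -- multiply by `C` and use the upper bound on `k * C`
      refine le_of_mul_le_mul_right (a := C) ?_ hC0
      calc 3 * (M * s) * (4 * (d * k)) * C = 12 * M * s * d * (k * C) := by ring
        _ ≤ 12 * M * s * d * (3 * d * s) := by gcongr
        _ = 36 * d ^ 2 * M * s ^ 2 := by ring
        _ ≤ 48 * d ^ 2 * M * s ^ 2 := by gcongr; norm_num
        _ ≤ C * a * s ^ 2 := by gcongr
        _ = a * s ^ 2 * C := by ring
    have h3 := h2e (M * s)
    calc 2 ^ (M * s) * (2 ^ (M * s) * (2 * Real.exp (-(a / (4 * (d * k)) * s ^ 2))))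
        ≤ Real.exp (M * s : ℕ) * (Real.exp (M * s : ℕ) * (2 * Real.exp (-(3 * (M * s))))) := by
          gcongr
      _ = 2 * Real.exp (-(M * s)) := by
          rw [mul_left_comm _ (2 : ℝ), mul_left_comm _ (2 : ℝ), ← Real.exp_add, ← Real.exp_add]
          push_cast
          ring_nf
      _ ≤ _ := by
          rw [one_mul]
          gcongr
          exact_mod_cast hms
  set E := Real.exp (-(1 * L)) with hE
  have hE0 : 0 < E := Real.exp_pos _
  have hLd : (k : ℝ) ^ d ≤ L ^ (d + 1) :=
    (pow_le_pow_left₀ hk0'.le hkL d).trans (pow_le_pow_right₀ hL (by omega))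
  have hLd' : (k : ℝ) ^ d * k ≤ L ^ (d + 1) := by
    rw [← pow_succ]; exact pow_le_pow_left₀ hk0'.le hkL _
  calc _ ≤ (k : ℝ) ^ d * E + (n * (2 * E) + k ^ d * (d * (d * k * (2 * E)))) := by gcongr
    _ = (k : ℝ) ^ d * E + (2 * n + 2 * d ^ 2 * (k ^ d * k)) * E := by ring
    _ ≤ L ^ (d + 1) * E + (2 * L ^ (d + 1) + 2 * d ^ 2 * L ^ (d + 1)) * E := by
        rw [← hLn]; gcongr
    _ = _ := by ring

theorem tendsto_temporally_connected {d M : ℕ} (hd : 1 ≤ d) {a C : ℝ} (ha0 : 0 < a) (ha : a ≤ 1)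
    (hM : 16 / a + 1 ≤ M) (hC : 48 * d ^ 2 * M / a ≤ C) {K : ℝ → ℝ} (hKm : Measurable K)
    (hKa : ∀ t, 0 ≤ t → t ≤ 1 → a ≤ K t) {r : ℕ → ℝ}
    (hrC : ∀ᶠ n : ℕ in atTop, C * (n : ℝ) ^ (-(1 / ((d : ℝ) + 1))) ≤ r n) :
    Tendsto (fun n : ℕ => volume {ω : TRGGSample d n |
      (temporalRGG K (r n) ω).TemporallyConnected}) atTop (𝓝 1) := by
  have hd' : (1 : ℝ) ≤ d := by exact_mod_cast hd
  have : NeZero d := ⟨by omega⟩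
  have hM2 : (2 : ℝ) ≤ M := by
    have : 1 ≤ 16 / a := by rw [le_div_iff₀ ha0]; linarith
    linarith
  have hC0 : 0 < C := lt_of_lt_of_le (by positivity) hC
  refine tendsto_volume_one_of_compl
    (tendsto_hopScale_pow_mul_exp_neg d (d + 1) (3 + 2 * d ^ 2) one_pos) ?_
  filter_upwards [hrC, (tendsto_hopScale d).eventually_ge_atTop 1,
    (tendsto_hopScale d).eventually_ge_atTop C] with n hn hL hLC
  rw [rpow_neg_eq_inv_hopScale] at hn
  have hLn := hopScale_pow d n
  set L := hopScale d n
  have hL0 : 0 < L := by linarith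
  have hdL : 1 ≤ d * L / C := by
    rw [le_div_iff₀ hC0]; nlinarith
  set k := ⌈2 * d * L / C⌉₊ with hk
  have hk1 : 2 * d * L / C ≤ k := Nat.le_ceil _
  have hk2 : (k : ℝ) ≤ 3 * d * L / C := by
    have := (Nat.ceil_lt_add_one (show 0 ≤ 2 * d * L / C by positivity)).le
    calc (k : ℝ) ≤ 2 * d * L / C + 1 := this
      _ ≤ 2 * d * L / C + d * L / C := by gcongr
      _ = _ := by ring
  have hk3 : 2 ≤ k := by
    have h : (2 : ℝ) ≤ 2 * d * L / C := by
      rw [show 2 * d * L / C = 2 * (d * L / C) by ring]; linarith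
    exact_mod_cast h.trans hk1
  have : NeZero k := ⟨by omega⟩
  have hk0 : (0 : ℝ) < k := Nat.cast_pos.2 (by omega)
  have hr : 2 * d / k ≤ r n := by
    refine le_trans ?_ hn
    rw [div_le_iff₀ hk0]
    calc (2 * d : ℝ) = C * L⁻¹ * (2 * d * L / C) := by field_simp
      _ ≤ C * L⁻¹ * k := by gcongr
  set s := ⌈L⌉₊ with hs
  have hs1 : L ≤ s := Nat.le_ceil _
  have hs2 : (s : ℝ) ≤ 2 * L := by
    have := (Nat.ceil_lt_add_one hL0.le).le
    linarith
  have hms : 2 * s ≤ M * s := Nat.mul_le_mul_right s (by exact_mod_cast hM2)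
  exact (volume_not_connected_le hk3 hKm ha0.le ha hKa hr hms).trans
    (ENNReal.ofReal_le_ofReal (union_bound_le hd ha0 ha hL hLn hM hC hs1 hs2 (by omega) hk2))

theorem theorem1 (d : ℕ) (hd : 2 ≤ d) (α β : ℝ) (hα : 0 < α) (hβ : 0 < β) :
    ∃ c : ℝ, 0 < c ∧ ∃ C : ℝ, 0 < C ∧
      ∀ K : ℝ → ℝ, Measurable K →
        (∀ x : ℝ, 0 ≤ x → 0 ≤ K x ∧ K x ≤ 1) →
        (∀ x : ℝ, 0 ≤ x → x ≤ 1 → α ≤ K x) →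
        (∀ x : ℝ, 1 < x → K x ≤ β * (x ^ d)⁻¹ * Real.exp (-((x + 1) * Real.log (x + 1)))) →
        ∀ r : ℕ → ℝ, (∀ n, 0 < r n) →
          ((∀ᶠ n : ℕ in atTop, r n ≤ c * (n : ℝ) ^ (-(1 / ((d : ℝ) + 1)))) →
            Tendsto (fun n : ℕ => volume {ω : TRGGSample d n |
                ¬ (temporalRGG K (r n) ω).TemporallyConnected}) atTop (𝓝 1) ∧
            Tendsto (fun n : ℕ => volume {ω : TRGGSample d n |
                ∀ u : Fin n, ¬ (temporalRGG K (r n) ω).IsTemporalSource u}) atTop (𝓝 1)) ∧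
          ((∀ᶠ n : ℕ in atTop, C * (n : ℝ) ^ (-(1 / ((d : ℝ) + 1))) ≤ r n) →
            Tendsto (fun n : ℕ => volume {ω : TRGGSample d n |
                (temporalRGG K (r n) ω).TemporallyConnected}) atTop (𝓝 1)) := by
  have hd0 : 0 < d := by omega
  have hd' : (0 : ℝ) < d := Nat.cast_pos.2 hd0
  set B : ℝ := max β (Real.exp 1)
  have hB : 0 < B := lt_max_of_lt_left hβ
  set a : ℝ := min α 1
  have ha0 : 0 < a := lt_min hα one_pos
  obtain ⟨M, hM⟩ := exists_nat_ge (16 / a + 1)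
  have hM0 : (0 : ℝ) < M := lt_of_lt_of_le (by positivity) hM
  refine ⟨min 1 (1 / (64 * (B * (4 * d) ^ d))), by positivity, 48 * d ^ 2 * M / a, by positivity,
    fun K hKm hK01 hKα hKβ r hr => ⟨fun hrc => ?_, fun hrC => ?_⟩⟩
  · have hsource := tendsto_no_temporal_source hd0 hB (min_le_left _ _) (min_le_right _ _) hKm
      (fun t ht => connection_le_exp hβ hK01 hKβ ht) hr hrc
    refine ⟨tendsto_of_tendsto_of_tendsto_of_le_of_le' hsource tendsto_const_nhds ?_
      (Eventually.of_forall fun n => prob_le_one), hsource⟩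
    filter_upwards [eventually_gt_atTop 0] with n hn
    exact measure_mono fun ω hω hconn => hω ⟨0, hn⟩ (hconn _)
  · exact tendsto_temporally_connected hd0 ha0 (min_le_right _ _) hM le_rfl hKm
      (fun t ht0 ht1 => (min_le_left _ _).trans (hKα t ht0 ht1)) hrC
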